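/- **Setting.** There are $n$ users with one bid each. Given bids $b\in[0,\infty)^n$, sorted as $b_{(1)}\ge\dots\ge b_{(n)}$, the *monopolistic auction* lets $k^*$ be the largest $k\in\{1,\dots,n\}$ that maximizes $k\,b_{(k)}$, confirms the $k^*$ highest bids (the number of served bids is not capped otherwise), and charges every confirmed user the price $b_{(k^*)}$, paid to the miner; unconfirmed users pay nothing. For a vector of values $v\in[0,\infty)^n$ and a user $i$, let $p^*_i$ be the minimal price that user $i$ can pay, over all bids $x\ge 0$ for which $i$ is confirmed when the other users bid $v_{-i}$, and let $p^t_i$ be what user $i$ pays if all users, $i$ included, bid their values. The *discount ratio* of $i$ is $$\delta_i(v_i,v_{-i})=\begin{cases}\dfrac{p^t_i-p^*_i}{p^t_i} & \text{if } v_i\ge p^*_i,\\[1ex] 0&\text{otherwise,}\end{cases}$$ and is read as $0$ if $p^t_i=0$. For a probability distribution $F$ on $[0,\infty)$ and $v_1,\dots,v_n$ drawn i.i.d. from $F$, put $$\Delta^{avg}_n=\mathbf E\,\delta_1(v_1,v_{-1}),\qquad \Delta^{max}_n=\mathbf E\max_{1\le j\le n}\delta_j(v_j,v_{-j}).$$ A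 mechanism is called *nearly UIC* (in terms of the discount ratio) if there is a constant $\beta>0$ such that for every $F$, as $n\to\infty$, $\Delta^{avg}_n\to0$ and $\Delta^{avg}_n=O(1/n^{\beta})$; here and below the constant in $O(\cdot)$ may depend on $F$, but $\beta$ may not. **Proposition.** The monopolistic auction is nearly UIC. More precisely, the expectations above are well defined (the integrands are integrable), and: 1. If $F$ has bounded support, then $\Delta^{max}_n\to0$, and in particular $\Delta^{max}_n=O(1/\sqrt n)$. 2. For every $F$, $\Delta^{avg}_n\to0$, and in particular $\Delta^{avg}_n=O(1/\sqrt n)$. -/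

import Mathlib

open MeasureTheory Filter Topology Asymptotics
open scoped NNReal

/-- A deterministic transaction fee mechanism, in reduced form: for every number `m` of users, and
every vector of `m` bids in `[0, ∞)`, it says which bids are confirmed, what each user pays, and
what revenue the miner receives. -/
structure FeeMechanism where
  confirmed : ∀ {m : ℕ}, (Fin m → ℝ≥0) → Fin m → Prop
  payment : ∀ {m : ℕ}, (Fin m → ℝ≥0) → Fin m → ℝ≥0
  revenue : ∀ {m : ℕ}, (Fin m → ℝ≥0) → ℝ≥0

namespace FeeMechanism

/-- The price `p*` of user `i` : the minimal price that `i` can pay to have a bid of `i`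
confirmed, the bids of the other users being those of `b` (the entry `b i` plays no role). -/
noncomputable def minPrice (T : FeeMechanism) {m : ℕ} (b : Fin m → ℝ≥0) (i : Fin m) : ℝ≥0 :=
  sInf {q : ℝ≥0 | ∃ x : ℝ≥0, T.confirmed (Function.update b i x) i ∧
    T.payment (Function.update b i x) i = q}

/-- The discount ratio of user `i` when the values are `v` and the other users bid truthfully:
`(pᵗ - p*) / pᵗ` if `v i ≥ p*`, where `pᵗ` is what `i` pays when bidding truthfully,
and `0` otherwise. It is `0` also if `pᵗ = 0`. -/
noncomputable def discountRatio (T : FeeMechanism) {m : ℕ} (v : Fin m → ℝ≥0) (i : Fin m) : ℝ :=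
  if T.minPrice v i ≤ v i then
    ((T.payment v i : ℝ) - (T.minPrice v i : ℝ)) / (T.payment v i : ℝ)
  else 0

/-- The average discount ratio for `n` i.i.d. values with law `F` : the expected discount ratio
of the first user (the value at `n = 0` is irrelevant). -/
noncomputable def avgDiscountRatio (T : FeeMechanism) (F : Measure ℝ≥0) : ℕ → ℝ
  | 0 => 0
  | n + 1 => ∫ v : Fin (n + 1) → ℝ≥0, T.discountRatio v 0 ∂(Measure.pi fun _ => F)

/-- The max discount ratio for `n` i.i.d. values with law `F` : the expectation of the largest
discount ratio among the `n` users. -/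
noncomputable def maxDiscountRatio (T : FeeMechanism) (F : Measure ℝ≥0) (n : ℕ) : ℝ :=
  ∫ v : Fin n → ℝ≥0, (⨆ j : Fin n, T.discountRatio v j) ∂(Measure.pi fun _ => F)

/-- Nearly user incentive compatible, in terms of the discount ratio: for every law `F` on
`[0, ∞)` the average discount ratio tends to `0`, and it is `O(1 / n ^ β)` for some `β > 0`
that does not depend on `F`. -/
def NearlyUIC (T : FeeMechanism) : Prop :=
  ∃ β : ℝ, 0 < β ∧ ∀ (F : Measure ℝ≥0) [IsProbabilityMeasure F],
    Tendsto (T.avgDiscountRatio F) atTop (𝓝 0) ∧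
    (T.avgDiscountRatio F) =O[atTop] (fun n : ℕ => 1 / (n : ℝ) ^ β)

end FeeMechanism

/-- The `k`-th highest bid, `1 ≤ k ≤ m`, repetitions being counted; `0` for any other `k`. -/
noncomputable def kthHighest {m : ℕ} (b : Fin m → ℝ≥0) (k : ℕ) : ℝ≥0 :=
  if h : 1 ≤ k ∧ k ≤ m then b (Tuple.sort b ⟨m - k, by omega⟩) else 0

/-- The number `k*` of bids that the monopolistic auction serves: the (largest) maximizer of
`k * b_k` over `1 ≤ k ≤ m`, where `b_1 ≥ b_2 ≥ … ≥ b_m` are the sorted bids. -/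
noncomputable def monopolyCount {m : ℕ} (b : Fin m → ℝ≥0) : ℕ :=
  open Classical in
  Nat.findGreatest (fun k => ∀ j ≤ m, (j : ℝ≥0) * kthHighest b j ≤ (k : ℝ≥0) * kthHighest b k) m

/-- The monopolistic price `b_{k*}`. -/
noncomputable def monopolyPrice {m : ℕ} (b : Fin m → ℝ≥0) : ℝ≥0 :=
  kthHighest b (monopolyCount b)

/-- The monopolistic auction: the `k*` highest bids are confirmed, each pays `b_{k*}` to the
miner, the others pay nothing. By maximality of `k*` exactly `k*` bids are at least `b_{k*}`,
so there are no ties to break among bids. -/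
noncomputable def monopolisticAuction : FeeMechanism where
  confirmed b i := monopolyPrice b ≤ b i
  payment b i := if monopolyPrice b ≤ b i then monopolyPrice b else 0
  revenue b := (monopolyCount b : ℝ≥0) * monopolyPrice b

/-! Let N be the demand at the monopolistic price P, and weight the largest discount by the share of
users served: M = (N/n) · max_j δ_j (`discountMass`). Only the N confirmed users can have a non-zero
discount, so exchangeability gives Δ^avg ≤ E M. If F has bounded support and is not concentrated at
0, then N/n is bounded below outside an event of probability O(1/n), so E M controls Δ^max as well.
Everything thus reduces to E M ≤ C/√n, with C independent of F (`exists_integral_discountMass_le`).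

If M > η, a single user could lower the price by underbidding. One bid changes each demand by at
most one, so some q < P has revenue at least P(N - 1) and sells to at least N + ηn - 1 users
(`exists_near_tie_of_lt_discountRatio`). Such a near tie between distant prices is rare, as follows.
Draw each value by choosing uniformly one of K blocks of quantiles, K of order 1/η, and then a point
of that block. Once the points are fixed, only the assignment of users to blocks is random, and the
problem becomes a count (`pi_measureReal_le_of_card_le`). If the blocks have about equal size, P
lies in a block `mid` and q lies beyond its neighbours `lo` and `hi`.

Now redistribute the c users of `lo` and `hi` by fair coins. When s of them land in `lo`, the
revenue of a price in `mid` is linear in s, while prices beyond the neighbours keep their revenue.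
Apart from small s, near ties occupy a bounded window of values of s, and for every larger s the
block `mid` wins strictly. A binomial coefficient is at most O(g/√c) times its upper tail plus a
small error, so P(tie) ≤ O(g/√c) P(win) + error (`card_nearTie_le`). At most two middle blocks can
win at once (`card_blockWins_le_two`), so the sum over blocks costs no factor K in the main term.
With c of order n/K and g = K^(1/4) this gives P(M > η) = O(η^(-3/4)/√n + η^(-2)/n), which a
layer-cake sum turns into O(1/√n). -/

/-- The demand at price `p`: the number of bids that are at least `p`. -/
noncomputable def bidCount {m : ℕ} (b : Fin m → ℝ≥0) (p : ℝ≥0) : ℕ :=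
  (Finset.univ.filter fun i => p ≤ b i).card

/-! ### Demand, and the monopolistic price as a revenue maximizer -/

section BidCount

variable {m : ℕ}

lemma bidCount_le (b : Fin m → ℝ≥0) (p : ℝ≥0) : bidCount b p ≤ m := by
  simpa [bidCount] using Finset.card_filter_le (Finset.univ : Finset (Fin m)) (fun i => p ≤ b i)

lemma bidCount_mono {b b' : Fin m → ℝ≥0} {p p' : ℝ≥0} (h : ∀ i, p ≤ b i → p' ≤ b' i) :
    bidCount b p ≤ bidCount b' p' :=
  Finset.card_le_card fun i hi => by
    simp only [Finset.mem_filter, Finset.mem_univ, true_and] at hi ⊢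
    exact h i hi

lemma bidCount_antitone (b : Fin m → ℝ≥0) : Antitone (bidCount b) :=
  fun _ _ h => bidCount_mono fun _ hi => h.trans hi

lemma bidCount_comp_perm (b : Fin m → ℝ≥0) (σ : Equiv.Perm (Fin m)) (p : ℝ≥0) :
    bidCount (b ∘ σ) p = bidCount b p := by
  unfold bidCount
  refine Finset.card_bij (fun i _ => σ i) ?_ ?_ ?_
  · intro i hi; simpa using hi
  · intro i _ j _ h; exact σ.injective h
  · intro j hj; exact ⟨σ.symm j, by simpa using hj, by simp⟩

/-- Sorted bids and demand are inverse to each other in the Galois sense; this allows sorting to be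
replaced by demand. -/
lemma le_kthHighest_iff (b : Fin m → ℝ≥0) {k : ℕ} (h1 : 1 ≤ k) (h2 : k ≤ m) (p : ℝ≥0) :
    p ≤ kthHighest b k ↔ k ≤ bidCount b p := by
  have hs : Monotone (b ∘ Tuple.sort b) := Tuple.monotone_sort b
  have h := Tuple.lt_card_lt_iff_apply_lt_of_monotone (f := b ∘ Tuple.sort b) (a := p)
    (j := ⟨m - k, by omega⟩) hs
  rw [← bidCount_comp_perm b (Tuple.sort b), kthHighest, dif_pos ⟨h1, h2⟩, ← not_lt]
  have hc := Finset.card_filter_add_card_filter_not (s := (Finset.univ : Finset (Fin m)))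
    (fun i => p ≤ (b ∘ Tuple.sort b) i)
  simp only [not_le, Finset.card_univ, Fintype.card_fin] at hc
  rw [Function.comp_apply] at h
  rw [← h, bidCount]
  simp only at *
  omega

lemma kthHighest_zero (b : Fin m → ℝ≥0) : kthHighest b 0 = 0 := by simp [kthHighest]

/-- The monopolistic price is the least price that maximizes revenue. -/
lemma monopolyPrice_isLeast (b : Fin m → ℝ≥0) :
    IsLeast {p : ℝ≥0 | ∀ p', p' * bidCount b p' ≤ p * bidCount b p} (monopolyPrice b) := by
  classical
  -- `hN` and `hN'` compare the two revenue functions, over counts k and over prices p, in both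
  -- directions, so their maxima agree.
  have hN : ∀ k ≤ m, (k : ℝ≥0) * kthHighest b k ≤ kthHighest b k * bidCount b (kthHighest b k) := by
    intro k hk
    rcases Nat.eq_zero_or_pos k with rfl | h
    · simp
    · rw [mul_comm]
      gcongr
      exact (le_kthHighest_iff b h hk _).1 le_rfl
  have hN' : ∀ p, p * bidCount b p ≤ (bidCount b p : ℝ≥0) * kthHighest b (bidCount b p) := by
    intro p
    rcases Nat.eq_zero_or_pos (bidCount b p) with h | h
    · simp [h]
    · rw [mul_comm]
      gcongr
      exact (le_kthHighest_iff b h (bidCount_le b p) _).2 le_rfl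
  obtain ⟨k₀, hk₀, hmax₀⟩ := Finset.exists_max_image (Finset.range (m + 1))
    (fun k => (k : ℝ≥0) * kthHighest b k) ⟨0, by simp⟩
  have hmax₀' : ∀ j ≤ m, (j : ℝ≥0) * kthHighest b j ≤ (k₀ : ℝ≥0) * kthHighest b k₀ :=
    fun j hj => hmax₀ j (Finset.mem_range.2 (by omega))
  have hk₀m : k₀ ≤ m := by have := Finset.mem_range.1 hk₀; omega
  have hspec : ∀ j ≤ m, (j : ℝ≥0) * kthHighest b j ≤
      (monopolyCount b : ℝ≥0) * kthHighest b (monopolyCount b) :=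
    Nat.findGreatest_spec (P := fun k => ∀ j ≤ m, (j : ℝ≥0) * kthHighest b j ≤
      (k : ℝ≥0) * kthHighest b k) hk₀m hmax₀'
  have hle : monopolyCount b ≤ m := Nat.findGreatest_le m
  have hgr : ∀ k ≤ m, (∀ j ≤ m, (j : ℝ≥0) * kthHighest b j ≤ (k : ℝ≥0) * kthHighest b k) →
      k ≤ monopolyCount b := fun k hk h => Nat.le_findGreatest hk h
  refine ⟨fun p' => ?_, fun p hp => ?_⟩
  · exact (hN' p').trans ((hspec _ (bidCount_le b p')).trans (hN _ hle))
  · by_contra hlt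
    push Not at hlt
    have hpos : 0 < monopolyPrice b := (zero_le (a := p)).trans_lt hlt
    -- The demand at a maximizing price is a maximizing count, hence at most k*; then k* · P ≤ p ·
    -- k*, which contradicts p < P.
    have h1 := hgr (bidCount b p) (bidCount_le b p)
      fun j hj => (hN j hj).trans ((hp _).trans (hN' p))
    have hk : 0 < monopolyCount b := by
      rcases Nat.eq_zero_or_pos (monopolyCount b) with h | h
      · rw [monopolyPrice, h, kthHighest_zero] at hpos
        exact absurd hpos (lt_irrefl _)
      · exact h
    have h2 : (monopolyCount b : ℝ≥0) * monopolyPrice b ≤ p * monopolyCount b :=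
      ((hN _ hle).trans (hp _)).trans (by gcongr)
    rw [mul_comm] at h2
    exact absurd (le_of_mul_le_mul_right h2 (by exact_mod_cast hk)) (not_le.2 hlt)

lemma revenue_le_monopoly (b : Fin m → ℝ≥0) (p : ℝ≥0) :
    p * bidCount b p ≤ monopolyPrice b * bidCount b (monopolyPrice b) :=
  (monopolyPrice_isLeast b).1 p

lemma monopolyPrice_comp_perm (b : Fin m → ℝ≥0) (σ : Equiv.Perm (Fin m)) :
    monopolyPrice (b ∘ σ) = monopolyPrice b := by
  have h := monopolyPrice_isLeast (b ∘ σ)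
  simp only [bidCount_comp_perm] at h
  exact h.unique (monopolyPrice_isLeast b)

lemma monopolyPrice_le_of_forall_le {b : Fin m → ℝ≥0} {x : ℝ≥0} (h : ∀ i, b i ≤ x) :
    monopolyPrice b ≤ x := by
  by_contra hlt
  push Not at hlt
  have h0 : bidCount b (monopolyPrice b) = 0 := by
    rw [bidCount, Finset.card_eq_zero, Finset.filter_eq_empty_iff]
    intro i _ hi
    exact absurd (hi.trans (h i)) (not_le.2 hlt)
  have := (monopolyPrice_isLeast b).2 (show (0 : ℝ≥0) ∈ _ from fun p' => by
    have := revenue_le_monopoly b p'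
    rw [h0] at this
    simpa using this)
  exact absurd (this.trans zero_le) (not_le.2 hlt)

end BidCount

/-! ### The minimal price, the discount ratio, and near ties -/

section MinPrice

variable {m : ℕ}

lemma bidCount_update_of_lt (v : Fin m → ℝ≥0) (i : Fin m) {x y p : ℝ≥0} (hx : x < p) (hy : y < p) :
    bidCount (Function.update v i x) p = bidCount (Function.update v i y) p := by
  apply le_antisymm <;> refine bidCount_mono fun j => ?_ <;> rcases eq_or_ne j i with rfl | h
  · simp [not_le.2 hx]
  · simp [h]
  · simp [not_le.2 hy]
  · simp [h]

lemma bidCount_update_of_le (v : Fin m → ℝ≥0) (i : Fin m) {x y p : ℝ≥0} (hx : p ≤ x) (hy : p ≤ y) :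
    bidCount (Function.update v i x) p = bidCount (Function.update v i y) p := by
  apply le_antisymm <;> refine bidCount_mono fun j => ?_ <;> rcases eq_or_ne j i with rfl | h
  · simp [hy]
  · simp [h]
  · simp [hx]
  · simp [h]

lemma bidCount_update_mono (v : Fin m → ℝ≥0) (i : Fin m) {x y : ℝ≥0} (h : x ≤ y) (p : ℝ≥0) :
    bidCount (Function.update v i x) p ≤ bidCount (Function.update v i y) p := by
  refine bidCount_mono fun j => ?_
  rcases eq_or_ne j i with rfl | hj
  · simpa using fun hp => hp.trans h
  · simp [hj]

/-- Raising a confirmed bid keeps it confirmed. -/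
lemma confirmed_mono (v : Fin m → ℝ≥0) (i : Fin m) {x y : ℝ≥0} (hxy : x ≤ y)
    (h : monopolyPrice (Function.update v i x) ≤ x) :
    monopolyPrice (Function.update v i y) ≤ y := by
  by_contra hlt
  push Not at hlt
  have hp := (monopolyPrice_isLeast (Function.update v i x)).1
  set p := monopolyPrice (Function.update v i x)
  -- If the new price exceeded y, its demand would be the same under both bids, as would the demand
  -- at the old price p. So p would still be optimal, and the least optimal price would be at most
  -- p.
  have key := (monopolyPrice_isLeast (Function.update v i y)).2 (show p ∈ _ from fun p' => by
    refine (revenue_le_monopoly _ p').trans ?_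
    rw [bidCount_update_of_lt v i hlt (hxy.trans_lt hlt),
      bidCount_update_of_le v i (h.trans hxy) h]
    exact hp _)
  exact absurd (key.trans (h.trans hxy)) (not_le.2 hlt)

/-- A confirmed user stays confirmed when bidding exactly the price. -/
lemma confirmed_at_price (v : Fin m → ℝ≥0) (i : Fin m) {x : ℝ≥0}
    (h : monopolyPrice (Function.update v i x) ≤ x) :
    monopolyPrice (Function.update v i (monopolyPrice (Function.update v i x))) ≤
      monopolyPrice (Function.update v i x) := by
  have hp := (monopolyPrice_isLeast (Function.update v i x)).1
  set p := monopolyPrice (Function.update v i x)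
  refine (monopolyPrice_isLeast (Function.update v i p)).2 fun p' => ?_
  calc p' * (bidCount (Function.update v i p) p' : ℝ≥0)
      ≤ p' * bidCount (Function.update v i x) p' := by
        gcongr; exact bidCount_update_mono v i h p'
    _ ≤ p * bidCount (Function.update v i x) p := hp p'
    _ = _ := by rw [bidCount_update_of_le v i h le_rfl]

lemma exists_confirmed (v : Fin m → ℝ≥0) (i : Fin m) :
    ∃ x, monopolyPrice (Function.update v i x) ≤ x := by
  refine ⟨∑ j, v j, monopolyPrice_le_of_forall_le fun j => ?_⟩
  rcases eq_or_ne j i with rfl | h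
  · simp
  · rw [Function.update_of_ne h]
    exact Finset.single_le_sum (fun _ _ => zero_le) (Finset.mem_univ j)

/-- A confirmed user may bid the price itself and stay confirmed, so p* is the infimum of the
confirmed bids. The strict form avoids asking whether the infimum is attained. -/
lemma minPrice_lt_iff (v : Fin m → ℝ≥0) (i : Fin m) (a : ℝ≥0) :
    monopolisticAuction.minPrice v i < a ↔
      ∃ x < a, monopolyPrice (Function.update v i x) ≤ x := by
  unfold FeeMechanism.minPrice monopolisticAuction
  simp only [Function.update_self]
  constructor
  · intro h
    obtain ⟨x₀, hx₀⟩ := exists_confirmed v i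
    obtain ⟨q, ⟨x, hx, rfl⟩, hqa⟩ := exists_lt_of_csInf_lt (Set.nonempty_of_mem
      (x := monopolyPrice (Function.update v i x₀)) (Exists.intro x₀ ⟨hx₀, if_pos hx₀⟩)) h
    rw [if_pos hx] at hqa
    exact ⟨_, hqa, confirmed_at_price v i hx⟩
  · rintro ⟨x, hxa, hx⟩
    refine lt_of_le_of_lt (csInf_le (OrderBot.bddBelow _) ⟨x, hx, rfl⟩) ?_
    rw [if_pos hx]
    exact hx.trans_lt hxa

lemma minPrice_le_monopolyPrice (v : Fin m → ℝ≥0) (i : Fin m) (h : monopolyPrice v ≤ v i) :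
    monopolisticAuction.minPrice v i ≤ monopolyPrice v := by
  refine le_of_forall_gt_imp_ge_of_dense fun a ha => ((minPrice_lt_iff v i a).2 ?_).le
  have h' : monopolyPrice (Function.update v i (v i)) ≤ v i := by simpa using h
  have := confirmed_at_price v i h'
  rw [Function.update_eq_self] at this
  exact ⟨monopolyPrice v, ha, this⟩

lemma discountRatio_of_lt (v : Fin m → ℝ≥0) (i : Fin m) (h : v i < monopolyPrice v) :
    monopolisticAuction.discountRatio v i = 0 := by
  simp [FeeMechanism.discountRatio, monopolisticAuction, not_le.2 h]

lemma discountRatio_of_le (v : Fin m → ℝ≥0) (i : Fin m) (h : monopolyPrice v ≤ v i) :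
    monopolisticAuction.discountRatio v i =
      ((monopolyPrice v : ℝ) - monopolisticAuction.minPrice v i) / monopolyPrice v := by
  have h1 := (minPrice_le_monopolyPrice v i h).trans h
  unfold FeeMechanism.discountRatio
  rw [if_pos h1]
  simp [monopolisticAuction, h]

lemma discountRatio_nonneg (v : Fin m → ℝ≥0) (i : Fin m) :
    0 ≤ monopolisticAuction.discountRatio v i := by
  rcases lt_or_ge (v i) (monopolyPrice v) with h | h
  · rw [discountRatio_of_lt v i h]
  · rw [discountRatio_of_le v i h]
    have : (monopolisticAuction.minPrice v i : ℝ) ≤ monopolyPrice v :=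
      mod_cast minPrice_le_monopolyPrice v i h
    exact div_nonneg (by linarith) (NNReal.coe_nonneg _)

lemma discountRatio_le_one (v : Fin m → ℝ≥0) (i : Fin m) :
    monopolisticAuction.discountRatio v i ≤ 1 := by
  rcases lt_or_ge (v i) (monopolyPrice v) with h | h
  · rw [discountRatio_of_lt v i h]; exact zero_le_one
  · rw [discountRatio_of_le v i h]
    have := NNReal.coe_nonneg (monopolisticAuction.minPrice v i)
    exact div_le_one_of_le₀ (by linarith) (NNReal.coe_nonneg _)

/-- A positive discount forces a lower price whose revenue is within one sale of the optimum,
and which sells to many more users. -/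
lemma exists_near_tie_of_lt_discountRatio (v : Fin m → ℝ≥0) (i : Fin m) {η : ℝ} (hη : 0 ≤ η)
    (h : η < monopolisticAuction.discountRatio v i) :
    ∃ q : ℝ≥0, q < monopolyPrice v ∧
      (monopolyPrice v : ℝ) * ((bidCount v (monopolyPrice v) : ℝ) - 1) ≤ q * bidCount v q ∧
      (bidCount v (monopolyPrice v) : ℝ) + η * bidCount v (monopolyPrice v) - 1 ≤
        bidCount v q := by
  have hi : monopolyPrice v ≤ v i := by
    by_contra hlt
    rw [discountRatio_of_lt v i (not_le.1 hlt)] at h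
    linarith
  rw [discountRatio_of_le v i hi] at h
  have hP0 : 0 < monopolyPrice v := by
    rcases eq_zero_or_pos (monopolyPrice v) with h0 | h0
    · rw [h0] at h; simp at h; linarith
    · exact h0
  have hP : (0 : ℝ) < monopolyPrice v := hP0
  rw [lt_div_iff₀ hP] at h
  have hp0 := NNReal.coe_nonneg (monopolisticAuction.minPrice v i)
  have hη1 : η < 1 := by
    by_contra hge
    push Not at hge
    nlinarith
  -- A discount above η means p* < (1 - η)P, so some bid x below (1 - η)P is confirmed, at a price q
  -- ≤ x.
  obtain ⟨y, hy⟩ : ∃ y : ℝ≥0, (y : ℝ) = (1 - η) * monopolyPrice v :=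
    ⟨⟨_, mul_nonneg (by linarith) hP.le⟩, rfl⟩
  obtain ⟨x, hx, hxc⟩ := (minPrice_lt_iff v i y).1 (by
    rw [← NNReal.coe_lt_coe, hy]; linarith)
  have hx' : (x : ℝ) < (1 - η) * monopolyPrice v := by rw [← hy]; exact_mod_cast hx
  have hxP : x < monopolyPrice v := by
    rw [← NNReal.coe_lt_coe]; nlinarith
  have hrev := revenue_le_monopoly (Function.update v i x) (monopolyPrice v)
  set q := monopolyPrice (Function.update v i x) with hq
  have hqP : q < monopolyPrice v := hxc.trans_lt hxP
  -- Both bids of user i accept q, so the demand at q is unchanged; at P at most one buyer is lost.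
  -- Optimality of q for the modified bids then gives the near tie.
  have hcq : bidCount (Function.update v i x) q = bidCount v q := by
    rw [bidCount_update_of_le v i hxc (hxc.trans (hxP.le.trans hi)), Function.update_eq_self]
  have hcP : bidCount v (monopolyPrice v) ≤
      bidCount (Function.update v i x) (monopolyPrice v) + 1 := by
    unfold bidCount
    refine (Finset.card_le_card (t := insert i (Finset.univ.filter fun j =>
      monopolyPrice v ≤ Function.update v i x j)) fun j hj => ?_).trans (Finset.card_insert_le _ _)
    rcases eq_or_ne j i with rfl | hji
    · simp
    · simpa [hji] using hj
  rw [hcq] at hrev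
  have hrev' : (monopolyPrice v : ℝ) *
      (bidCount (Function.update v i x) (monopolyPrice v) : ℝ) ≤ q * bidCount v q := by
    exact_mod_cast hrev
  have hcP' : (bidCount v (monopolyPrice v) : ℝ) ≤
      (bidCount (Function.update v i x) (monopolyPrice v) : ℝ) + 1 := by exact_mod_cast hcP
  have h1 : (monopolyPrice v : ℝ) * ((bidCount v (monopolyPrice v) : ℝ) - 1) ≤
      q * bidCount v q := le_trans (by gcongr; linarith) hrev'
  refine ⟨q, hqP, h1, ?_⟩
  have hqx : (q : ℝ) ≤ (1 - η) * monopolyPrice v := le_trans (by exact_mod_cast hxc) hx'.le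
  have hN : (bidCount v (monopolyPrice v) : ℝ) ≤ bidCount v q := by
    exact_mod_cast bidCount_antitone v hqP.le
  -- Dividing by P yields N - 1 ≤ (1 - η)N_q, and N ≤ N_q turns this into N_q ≥ N + ηN - 1.
  have h2 : (monopolyPrice v : ℝ) * ((bidCount v (monopolyPrice v) : ℝ) - 1) ≤
      monopolyPrice v * ((1 - η) * bidCount v q) := by
    refine h1.trans ?_
    calc (q : ℝ) * bidCount v q ≤ ((1 - η) * monopolyPrice v) * bidCount v q := by gcongr
      _ = _ := by ring
  have h3 := le_of_mul_le_mul_left h2 hP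
  nlinarith

lemma minPrice_comp_perm (v : Fin m → ℝ≥0) (σ : Equiv.Perm (Fin m)) (i : Fin m) :
    monopolisticAuction.minPrice (v ∘ σ) i = monopolisticAuction.minPrice v (σ i) := by
  have hu : ∀ x, Function.update (v ∘ σ) i x = Function.update v (σ i) x ∘ σ := by
    intro x
    ext j
    rcases eq_or_ne j i with rfl | h
    · simp
    · simp [h, σ.injective.ne h]
  refine eq_of_forall_gt_iff fun a => ?_
  simp only [minPrice_lt_iff, hu, monopolyPrice_comp_perm]

lemma discountRatio_comp_perm (v : Fin m → ℝ≥0) (σ : Equiv.Perm (Fin m)) (i : Fin m) :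
    monopolisticAuction.discountRatio (v ∘ σ) i = monopolisticAuction.discountRatio v (σ i) := by
  have hp : monopolisticAuction.payment (v ∘ σ) i = monopolisticAuction.payment v (σ i) := by
    simp only [monopolisticAuction, monopolyPrice_comp_perm, Function.comp_apply]
  simp only [FeeMechanism.discountRatio, minPrice_comp_perm, hp, Function.comp_apply]

end MinPrice

/-! ### Measurability of price and discount -/

section Measurability

variable {m : ℕ}

lemma measurable_bidCount (p : ℝ≥0) : Measurable fun b : Fin m → ℝ≥0 => bidCount b p := by
  unfold bidCount
  simp only [Finset.card_filter]
  refine Finset.measurable_sum _ fun i _ => Measurable.ite ?_ measurable_const measurable_const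
  exact measurableSet_le measurable_const (measurable_pi_apply i)

lemma measurable_kthHighest (k : ℕ) : Measurable fun b : Fin m → ℝ≥0 => kthHighest b k := by
  by_cases h : 1 ≤ k ∧ k ≤ m
  · refine measurable_of_Ici fun p => ?_
    have : (fun b : Fin m → ℝ≥0 => kthHighest b k) ⁻¹' Set.Ici p = {b | k ≤ bidCount b p} := by
      ext b
      exact le_kthHighest_iff b h.1 h.2 p
    rw [this]
    exact measurableSet_le measurable_const (measurable_bidCount p)
  · simp only [kthHighest, dif_neg h]
    exact measurable_const

lemma measurable_monopolyCount : Measurable fun b : Fin m → ℝ≥0 => monopolyCount b := by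
  classical
  unfold monopolyCount
  refine measurable_findGreatest fun k _ => ?_
  simp only [Set.ofPred_forall]
  refine MeasurableSet.iInter fun j => MeasurableSet.iInter fun _ => measurableSet_le ?_ ?_
  · exact (measurable_kthHighest j).const_mul _
  · exact (measurable_kthHighest k).const_mul _

lemma measurable_monopolyPrice : Measurable fun b : Fin m → ℝ≥0 => monopolyPrice b := by
  have h : Measurable fun x : (Fin m → ℝ≥0) × ℕ => kthHighest x.1 x.2 :=
    measurable_from_prod_countable_left fun k => measurable_kthHighest k
  exact h.comp (measurable_id.prodMk measurable_monopolyCount)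

lemma measurable_bidCount_monopolyPrice :
    Measurable fun b : Fin m → ℝ≥0 => bidCount b (monopolyPrice b) := by
  unfold bidCount
  simp only [Finset.card_filter]
  refine Finset.measurable_sum _ fun i _ => Measurable.ite ?_ measurable_const measurable_const
  exact measurableSet_le measurable_monopolyPrice (measurable_pi_apply i)

/-- By `confirmed_mono` the confirmed bids form an up-set, so the bid witnessing p* < a can be taken
in a countable dense set. -/
lemma measurable_minPrice (i : Fin m) :
    Measurable fun v : Fin m → ℝ≥0 => monopolisticAuction.minPrice v i := by
  obtain ⟨D, hDc, hD⟩ := TopologicalSpace.exists_countable_dense ℝ≥0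
  refine measurable_of_Iio fun a => ?_
  have : (fun v : Fin m → ℝ≥0 => monopolisticAuction.minPrice v i) ⁻¹' Set.Iio a =
      ⋃ x ∈ D ∩ Set.Iio a, {v | monopolyPrice (Function.update v i x) ≤ x} := by
    ext v
    simp only [Set.mem_preimage, Set.mem_Iio, minPrice_lt_iff, Set.mem_iUnion, Set.mem_inter_iff,
      Set.mem_ofPred_eq, exists_prop]
    constructor
    · rintro ⟨x, hxa, hx⟩
      obtain ⟨y, hyD, hxy, hya⟩ := hD.exists_between hxa
      exact ⟨y, ⟨hyD, hya⟩, confirmed_mono v i hxy.le hx⟩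
    · rintro ⟨x, ⟨_, hxa⟩, hx⟩
      exact ⟨x, hxa, hx⟩
  rw [this]
  refine MeasurableSet.biUnion (hDc.mono Set.inter_subset_left) fun x _ => ?_
  refine measurableSet_le (measurable_monopolyPrice.comp ?_) measurable_const
  refine measurable_pi_lambda _ fun j => ?_
  rcases eq_or_ne j i with rfl | h
  · simp
  · simpa [h] using measurable_pi_apply j

lemma measurable_discountRatio (i : Fin m) :
    Measurable fun v : Fin m → ℝ≥0 => monopolisticAuction.discountRatio v i := by
  have hp : Measurable fun v : Fin m → ℝ≥0 => monopolisticAuction.payment v i :=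
    Measurable.ite (measurableSet_le measurable_monopolyPrice (measurable_pi_apply i))
      measurable_monopolyPrice measurable_const
  refine Measurable.ite (measurableSet_le (measurable_minPrice i) (measurable_pi_apply i)) ?_
    measurable_const
  exact (hp.coe_nnreal_real.sub (measurable_minPrice i).coe_nnreal_real).div hp.coe_nnreal_real

end Measurability

/-! ### Second moments by counting -/

section SecondMoment

/-- The second moment of a sum of independent centred terms. -/
lemma card_mul_sum_sq_sum {κ : Type*} [Fintype κ] (f : κ → ℝ) (hf : ∑ x, f x = 0) (n : ℕ) :
    (Fintype.card κ : ℝ) * ∑ B : Fin n → κ, (∑ a, f (B a)) ^ 2 =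
      n * (Fintype.card κ : ℝ) ^ n * ∑ x, f x ^ 2 := by
  induction n with
  | zero => simp
  | succ n ih =>
    rw [← (Fin.consEquiv fun _ : Fin (n + 1) => κ).sum_comp]
    simp only [Fin.consEquiv_apply, Fin.sum_univ_succ, Fin.cons_zero, Fin.cons_succ,
      Fintype.sum_prod_type, add_sq, Finset.sum_add_distrib]
    have h2 : ∑ x, ∑ B : Fin n → κ, 2 * f x * ∑ a, f (B a) = 0 := by
      simp_rw [← Finset.mul_sum]
      rw [← Finset.sum_mul, ← Finset.mul_sum, hf]
      simp
    rw [h2]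
    simp only [Finset.sum_const, Finset.card_univ, Fintype.card_pi, Finset.prod_const,
      Fintype.card_fin, nsmul_eq_mul, ← Finset.mul_sum]
    push_cast
    rw [add_zero, mul_add, ih]
    ring

/-- Chebyshev's inequality for a sum of independent centred terms. -/
lemma card_abs_sum_ge_le {κ : Type*} [Fintype κ] (f : κ → ℝ) (hf : ∑ x, f x = 0)
    (n : ℕ) {y : ℝ} (hy : 0 ≤ y) :
    (Fintype.card κ : ℝ) *
      ((Finset.univ.filter fun B : Fin n → κ => y ≤ |∑ a, f (B a)|).card * y ^ 2) ≤
      n * (Fintype.card κ : ℝ) ^ n * ∑ x, f x ^ 2 := by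
  rw [← card_mul_sum_sq_sum f hf n]
  gcongr
  rw [← nsmul_eq_mul, ← Finset.sum_const]
  refine (Finset.sum_le_sum fun B hB => ?_).trans
    (Finset.sum_le_univ_sum_of_nonneg fun B => sq_nonneg (∑ a, f (B a)))
  rw [← sq_abs (∑ a, f (B a))]
  have := (Finset.mem_filter.1 hB).2
  gcongr

/-- The number of assignments of `n` users to `K` equally likely classes for which the size of a
given class deviates from its mean `n / K` by at least half of it. -/
lemma card_class_deviates_le {K : ℕ} (n : ℕ) (hn : 0 < n) (i : Fin K) :
    ((Finset.univ.filter fun B : Fin n → Fin K =>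
      (n : ℝ) / 2 ≤ |K * ((Finset.univ.filter fun a => B a = i).card : ℝ) - n|).card : ℝ) ≤
      4 * K / n * (K : ℝ) ^ n := by
  have hK : 0 < K := i.pos
  have hK' : (0 : ℝ) < K := by exact_mod_cast hK
  have hn' : (0 : ℝ) < n := by exact_mod_cast hn
  -- The summand K·1[x = i] - 1 is centred, and its sum over the users is K times the class size
  -- minus n.
  have h := card_abs_sum_ge_le (fun x : Fin K => (if x = i then (K : ℝ) else 0) - 1)
    (by simp) n (y := (n : ℝ) / 2) (by positivity)
  have hs : ∑ x : Fin K, ((if x = i then (K : ℝ) else 0) - 1) ^ 2 ≤ (K : ℝ) ^ 2 := by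
    have : ∀ x : Fin K, ((if x = i then (K : ℝ) else 0) - 1) ^ 2 =
        (if x = i then (K : ℝ) ^ 2 - 2 * K else 0) + 1 := by
      intro x; split_ifs <;> ring
    simp only [this, Finset.sum_add_distrib, Finset.sum_ite_eq', Finset.mem_univ, if_true,
      Finset.sum_const, Finset.card_univ, Fintype.card_fin, nsmul_eq_mul, mul_one]
    linarith
  have hc : ∀ B : Fin n → Fin K, ∑ a, ((if B a = i then (K : ℝ) else 0) - 1) =
      K * ((Finset.univ.filter fun a => B a = i).card : ℝ) - n := by
    intro B
    rw [Finset.sum_sub_distrib, ← Finset.sum_filter]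
    simp [mul_comm]
  simp only [hc, Fintype.card_fin] at h
  set N := ((Finset.univ.filter fun B : Fin n → Fin K =>
      (n : ℝ) / 2 ≤ |K * ((Finset.univ.filter fun a => B a = i).card : ℝ) - n|).card : ℝ)
  have h2 : (K : ℝ) * (N * ((n : ℝ) / 2) ^ 2) ≤ n * (K : ℝ) ^ n * (K : ℝ) ^ 2 :=
    h.trans (by gcongr)
  have h3 : (K * n / 4 : ℝ) * n * N ≤ (K * n / 4 : ℝ) * (4 * K * (K : ℝ) ^ n) := by
    nlinarith
  rw [mul_assoc] at h3
  have h4 := le_of_mul_le_mul_left h3 (by positivity)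
  rw [div_mul_eq_mul_div, le_div_iff₀ hn']
  linarith

end SecondMoment

/-! ### Binomial coefficients against their upper tails -/

section Binomial

lemma sum_le_sum_of_ne_zero_imp {ι : Type*} {s u : Finset ι} {f : ι → ℝ}
    (hf : ∀ i, 0 ≤ f i) (h : ∀ i ∈ s, f i ≠ 0 → i ∈ u) : ∑ i ∈ s, f i ≤ ∑ i ∈ u, f i := by
  classical
  rw [← Finset.sum_filter_ne_zero s]
  refine Finset.sum_le_sum_of_subset_of_nonneg (fun i hi => ?_) fun i _ _ => hf i
  exact h i (Finset.mem_filter.1 hi).1 (Finset.mem_filter.1 hi).2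

/-- The variance of a fair binomial variable, read off from the Bernstein polynomials at 1/2. -/
lemma sum_choose_mul_sq (c : ℕ) :
    ∑ t ∈ Finset.range (c + 1), (c.choose t : ℝ) * (2 * (t : ℝ) - c) ^ 2 = (c : ℝ) * 2 ^ c := by
  have h := congrArg (Polynomial.eval (1 / 2 : ℝ)) (bernsteinPolynomial.variance ℝ c)
  simp only [Polynomial.eval_finsetSum, bernsteinPolynomial, Polynomial.eval_mul,
    Polynomial.eval_pow, Polynomial.eval_sub, Polynomial.eval_X,
    Polynomial.eval_natCast, Polynomial.eval_one, nsmul_eq_mul] at h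
  have h2 : ∀ t ∈ Finset.range (c + 1), (c.choose t : ℝ) * (2 * (t : ℝ) - c) ^ 2 =
      4 * 2 ^ c * (((c : ℝ) * (1 / 2) - t) ^ 2 *
        (c.choose t * (1 / 2) ^ t * (1 - 1 / 2) ^ (c - t))) := by
    intro t ht
    have ht' : t ≤ c := by have := Finset.mem_range.1 ht; omega
    have h3 : (1 / 2 : ℝ) ^ t * (1 - 1 / 2) ^ (c - t) * 2 ^ c = 1 := by
      rw [show (1 - 1 / 2 : ℝ) = 1 / 2 by norm_num, ← pow_add, Nat.add_sub_cancel' ht',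
        ← mul_pow]
      norm_num
    linear_combination (-(c.choose t : ℝ) * (2 * t - c) ^ 2) * h3
  rw [Finset.sum_congr rfl h2, ← Finset.mul_sum, h]
  ring

/-- Chebyshev's inequality for a fair binomial variable. -/
lemma sum_choose_far_le (c : ℕ) {y : ℝ} (hy : 0 < y) (s : Finset ℕ)
    (hs : ∀ t ∈ s, y ≤ |2 * (t : ℝ) - c|) :
    ∑ t ∈ s, (c.choose t : ℝ) ≤ c * 2 ^ c / y ^ 2 := by
  rw [le_div_iff₀ (by positivity), ← sum_choose_mul_sq, Finset.sum_mul]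
  calc ∑ t ∈ s, (c.choose t : ℝ) * y ^ 2
      ≤ ∑ t ∈ s, (c.choose t : ℝ) * (2 * t - c) ^ 2 := by
        refine Finset.sum_le_sum fun t ht => ?_
        rw [← sq_abs (2 * (t : ℝ) - c)]
        have := hs t ht
        gcongr
    _ ≤ _ := by
        refine sum_le_sum_of_ne_zero_imp (fun t => by positivity) fun t _ hne => ?_
        rw [Finset.mem_range]
        by_contra hlt
        exact hne (by rw [Nat.choose_eq_zero_of_lt (by omega)]; simp)

/-- Consecutive coefficients have ratio (c - τ)/(τ + 1), which is at least 1 - δ as long as τ is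
within x + J of the centre; the losses then add up as in Bernoulli's inequality. -/
lemma choose_add_ge {c t J : ℕ} {x δ : ℝ} (ht : c / 2 ≤ t) (htx : 2 * (t : ℝ) ≤ c + 2 * x)
    (hδ : δ * c = 4 * x + 4 * J + 2) (hδ0 : 0 ≤ δ) (hδ1 : δ ≤ 1) (j : ℕ) (hj : j ≤ J) :
    (c.choose t : ℝ) * (1 - j * δ) ≤ c.choose (t + j) := by
  induction j with
  | zero => simp
  | succ j ih =>
    have ih := ih (by omega)
    have h1 : (c.choose (t + j) : ℝ) * (1 - δ) ≤ c.choose (t + (j + 1)) := by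
      have e := Nat.choose_succ_right_eq c (t + j)
      have e' : (c.choose (t + (j + 1)) : ℝ) * (t + j + 1) =
          c.choose (t + j) * ((c - (t + j) : ℕ) : ℝ) := by exact_mod_cast e
      have hτ : (c : ℝ) ≤ 2 * (t + j + 1) := by
        have : c ≤ 2 * (t + j + 1) := by omega
        exact_mod_cast this
      have hsub : (c : ℝ) - (t + j) ≤ ((c - (t + j) : ℕ) : ℝ) := by
        have := Nat.cast_le (α := ℝ).2 (show c ≤ (c - (t + j)) + (t + j) by omega)
        push_cast at this
        linarith
      have hjJ : (j : ℝ) + 1 ≤ J := by exact_mod_cast hj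
      have hlow : (1 - δ) * (t + j + 1) ≤ ((c - (t + j) : ℕ) : ℝ) := by
        nlinarith
      refine le_of_mul_le_mul_right ?_ (show (0 : ℝ) < t + j + 1 by positivity)
      rw [e', mul_assoc]
      gcongr
    have h0 : (0 : ℝ) ≤ c.choose t := by positivity
    calc (c.choose t : ℝ) * (1 - (j + 1 : ℕ) * δ)
        ≤ (c.choose t : ℝ) * (1 - j * δ) * (1 - δ) := by
          push_cast
          have : 0 ≤ (c.choose t : ℝ) * (j * δ * δ) := by positivity
          nlinarith
      _ ≤ c.choose (t + j) * (1 - δ) := by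
          have : 0 ≤ 1 - δ := by linarith
          gcongr
      _ ≤ _ := h1

lemma choose_le_choose_of_half_le {c s t : ℕ} (hs : c ≤ 2 * s + 1) (hst : s ≤ t) :
    c.choose t ≤ c.choose s := by
  induction t, hst using Nat.le_induction with
  | base => exact le_rfl
  | succ t hst ih =>
    refine le_trans ?_ ih
    have e := Nat.choose_succ_right_eq c t
    refine Nat.le_of_mul_le_mul_right ?_ (Nat.succ_pos t)
    rw [Nat.succ_eq_add_one, e]
    gcongr
    omega

/-- A binomial coefficient is at most the upper tail over a large multiple of the standard
deviation, up to a small error. -/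
lemma choose_le_tail {c : ℕ} {g : ℝ} (hg : 1 ≤ g) (hc : 24 * g ^ 2 ≤ √c) (t : ℕ) :
    (c.choose t : ℝ) ≤ 96 * g / √c * ∑ s ∈ Finset.Ioc t c, (c.choose s : ℝ) +
      2 / (g ^ 3 * √c) * 2 ^ c := by
  set r := √(c : ℝ) with hr
  have hr2 : r ^ 2 = c := Real.sq_sqrt (Nat.cast_nonneg c)
  have hg0 : 0 < g := by linarith
  have hr0 : 24 ≤ r := by nlinarith
  have hrg : 24 * g ≤ r := by nlinarith
  -- Far to the right of the centre, the at least g√c/2 coefficients ending at t are no smaller than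
  -- the one at t and all lie in a Chebyshev tail of total weight at most 2^c/g². This gives the
  -- error term.
  by_cases hB : (c : ℝ) + 2 * (g * r) < 2 * t
  · set L := ⌊g * r / 2⌋₊ + 1
    have hL : g * r / 2 ≤ L := by
      have := Nat.lt_floor_add_one (g * r / 2)
      push_cast [L]; linarith
    have hL' : ∀ i < L, (i : ℝ) ≤ g * r / 2 := fun i hi =>
      (Nat.le_floor_iff (by positivity)).1 (Nat.lt_succ_iff.1 hi)
    have hsum : (g * r / 2) * (c.choose t : ℝ) ≤ c * 2 ^ c / (g * r) ^ 2 := by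
      refine le_trans ?_ (sum_choose_far_le c (y := g * r) (by positivity)
        ((Finset.range L).image fun i => t - i) ?_)
      · rw [Finset.sum_image]
        · calc (g * r / 2) * (c.choose t : ℝ) ≤ L * (c.choose t : ℝ) := by gcongr
            _ = ∑ i ∈ Finset.range L, (c.choose t : ℝ) := by simp
            _ ≤ _ := by
              refine Finset.sum_le_sum fun i hi => ?_
              have hi' := hL' i (Finset.mem_range.1 hi)
              have hit : i ≤ t := by
                rw [← Nat.cast_le (α := ℝ)]; nlinarith [Nat.cast_nonneg (α := ℝ) c]
              have : c ≤ 2 * (t - i) + 1 := by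
                rw [← Nat.cast_le (α := ℝ)]; push_cast [hit]; nlinarith
              exact_mod_cast choose_le_choose_of_half_le this (Nat.sub_le t i)
        · intro i hi j hj hij
          have hi' := hL' i (Finset.mem_range.1 hi)
          have hj' := hL' j (Finset.mem_range.1 hj)
          have hit : i ≤ t := by
            rw [← Nat.cast_le (α := ℝ)]; nlinarith [Nat.cast_nonneg (α := ℝ) c]
          have hjt : j ≤ t := by
            rw [← Nat.cast_le (α := ℝ)]; nlinarith [Nat.cast_nonneg (α := ℝ) c]
          simp only at hij
          omega
      · intro t' ht'
        obtain ⟨i, hi, rfl⟩ := Finset.mem_image.1 ht'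
        have hi' := hL' i (Finset.mem_range.1 hi)
        have hit : i ≤ t := by
          rw [← Nat.cast_le (α := ℝ)]; nlinarith [Nat.cast_nonneg (α := ℝ) c]
        push_cast [hit]
        exact le_trans (by linarith) (le_abs_self _)
    have hC : (c.choose t : ℝ) ≤ 2 / (g ^ 3 * r) * 2 ^ c := by
      rw [le_div_iff₀ (by positivity), ← hr2] at hsum
      rw [div_mul_eq_mul_div, le_div_iff₀ (by positivity)]
      refine le_of_mul_le_mul_left (a := r ^ 2 / 2) ?_ (by positivity)
      linarith
    have : 0 ≤ 96 * g / r * ∑ s ∈ Finset.Ioc t c, (c.choose s : ℝ) := by positivity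
    linarith
  · push Not at hB
    -- J is short enough that the J coefficients after τ keep at least half of the one at τ (`hJδ`),
    -- and long enough that their sum is at least √c/(96g) times it. The hypothesis `hc` ensures J ≥
    -- 1.
    set J := ⌊r / (24 * g)⌋₊ with hJ
    have hJ1 : (J : ℝ) ≤ r / (24 * g) := Nat.floor_le (by positivity)
    have hJ0 : 1 ≤ J := by
      rw [hJ, Nat.one_le_floor_iff, le_div_iff₀ (by positivity)]; linarith
    have hJ0' : (1 : ℝ) ≤ J := by exact_mod_cast hJ0
    have hJ2 : r / (48 * g) ≤ J := by
      have h1 : r / (24 * g) < J + 1 := Nat.lt_floor_add_one _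
      have h2 : r / (48 * g) = r / (24 * g) / 2 := by field_simp; norm_num
      linarith
    rw [le_div_iff₀ (by positivity)] at hJ1
    set δ := (4 * (g * r) + 4 * J + 2) / c with hδ
    have hc0 : (0 : ℝ) < c := by rw [← hr2]; positivity
    have hδc : δ * c = 4 * (g * r) + 4 * J + 2 := by rw [hδ]; field_simp
    have hδ0 : 0 ≤ δ := by positivity
    have hJδ : J * δ ≤ 1 / 2 := by
      rw [hδ, ← mul_div_assoc, div_le_iff₀ hc0, ← hr2]
      have ha : J * (24 * g) * r ≤ r * r := by gcongr
      have hb : J * 24 ≤ r := le_trans (by gcongr; linarith) hJ1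
      have hc' : J * J ≤ (r / 24) * (r / 24) := by gcongr <;> linarith
      nlinarith
    have hδ1 : δ ≤ 1 := by nlinarith
    have key : ∀ τ : ℕ, c / 2 ≤ τ → 2 * (τ : ℝ) ≤ c + 2 * (g * r) →
        (c.choose τ : ℝ) ≤ 96 * g / r * ∑ s ∈ Finset.Ioc τ c, (c.choose s : ℝ) := by
      intro τ hτ hτx
      have h1 : (J : ℝ) * (c.choose τ / 2) ≤ ∑ s ∈ Finset.Ioc τ c, (c.choose s : ℝ) := by
        calc (J : ℝ) * (c.choose τ / 2) = ∑ s ∈ Finset.Ioc τ (τ + J), (c.choose τ / 2 : ℝ) := by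
              simp
          _ ≤ ∑ s ∈ Finset.Ioc τ (τ + J), (c.choose s : ℝ) := by
              refine Finset.sum_le_sum fun s hs => ?_
              obtain ⟨hs1, hs2⟩ := Finset.mem_Ioc.1 hs
              obtain ⟨j, rfl⟩ := Nat.exists_eq_add_of_le hs1.le
              have hj : j ≤ J := by omega
              refine le_trans ?_ (choose_add_ge hτ hτx hδc hδ0 hδ1 j hj)
              have : (j : ℝ) * δ ≤ 1 / 2 := le_trans (by gcongr) hJδ
              have h0 : (0 : ℝ) ≤ c.choose τ := by positivity
              nlinarith
          _ ≤ _ := by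
              refine sum_le_sum_of_ne_zero_imp (fun t => by positivity) fun s hs hne => ?_
              rw [Finset.mem_Ioc] at hs ⊢
              refine ⟨hs.1, ?_⟩
              by_contra hlt
              exact hne (by rw [Nat.choose_eq_zero_of_lt (by omega)]; simp)
      calc (c.choose τ : ℝ) = 96 * g / r * (r / (48 * g) * (c.choose τ / 2)) := by
            field_simp; ring
        _ ≤ 96 * g / r * (J * (c.choose τ / 2)) := by gcongr
        _ ≤ _ := by gcongr
    have hpos : (0 : ℝ) ≤ 2 / (g ^ 3 * r) * 2 ^ c := by positivity
    refine le_trans ?_ (le_add_of_nonneg_right hpos)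
    rcases le_or_gt (c / 2) t with h | h
    · exact key t h hB
    -- Left of the centre, the central coefficient dominates and its upper tail is contained in that
    -- of t.
    · have h2 : 2 * ((c / 2 : ℕ) : ℝ) ≤ c := by
        exact_mod_cast Nat.mul_div_le c 2
      calc (c.choose t : ℝ) ≤ c.choose (c / 2) := by exact_mod_cast Nat.choose_le_middle t c
        _ ≤ _ := key (c / 2) le_rfl (by nlinarith)
        _ ≤ _ := by
          gcongr

end Binomial

/-! ### Increasing lines against fixed levels -/

section Lines

/-- Some line `s ↦ v a * (k + s + r a)` is maximal at `s`, is positive, beats all the levels `Z b`,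
and beats one of them by at most its slope. -/
def TieAt {α β : Type*} (v : α → ℝ) (r : α → ℕ) (k : ℕ) (Z : β → ℝ) (s : ℕ) : Prop :=
  ∃ a, 0 < v a ∧ (∀ a', v a' * (k + s + r a' : ℝ) ≤ v a * (k + s + r a : ℝ)) ∧
    (∀ b, Z b ≤ v a * (k + s + r a : ℝ)) ∧ ∃ b, v a * (k + s + r a - 1 : ℝ) ≤ Z b

/-- Some line beats all the levels strictly. -/
def WinsAt {α β : Type*} (v : α → ℝ) (r : α → ℕ) (k : ℕ) (Z : β → ℝ) (s : ℕ) : Prop :=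
  ∃ a, ∀ b, Z b < v a * (k + s + r a : ℝ)

variable {α β : Type*} {v : α → ℝ} {r : α → ℕ} {k : ℕ} {Z : β → ℝ}

/-- The line of the tie has positive slope, while the levels do not move. -/
lemma TieAt.winsAt {s s' : ℕ} (h : TieAt v r k Z s) (hs : s < s') : WinsAt v r k Z s' := by
  obtain ⟨a, ha, -, hZ, -⟩ := h
  have hs' : (s : ℝ) < s' := by exact_mod_cast hs
  refine ⟨a, fun b => (hZ b).trans_lt ?_⟩
  gcongr

/-- Let x and x' be the counts of the two maximal lines at s and s + j. Maximality at s + j gives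
v(x + j) ≤ v'x', and the level nearly reached there gives v'(x' - 1) ≤ vx. Multiplying, j(x' - 1) ≤
x ≤ k + 17s, while x' - 1 ≥ k + s. -/
lemma TieAt.gap_le {s j : ℕ} (h : TieAt v r k Z s) (h' : TieAt v r k Z (s + j)) (hs : 1 ≤ s)
    (hr : ∀ a, r a ≤ 16 * s) : j ≤ 17 := by
  obtain ⟨a, ha, -, hZ, -⟩ := h
  obtain ⟨a', ha', hmax, -, b, hb⟩ := h'
  have h1 := hZ b
  have h2 := hmax a
  have hra : (r a : ℝ) ≤ 16 * s := by exact_mod_cast hr a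
  have hs0 : (1 : ℝ) ≤ s := by exact_mod_cast hs
  have hk0 : (0 : ℝ) ≤ k := Nat.cast_nonneg k
  have hr0 : (0 : ℝ) ≤ r a' := Nat.cast_nonneg _
  by_contra hj
  have hj' : (18 : ℝ) ≤ j := by exact_mod_cast not_le.1 hj
  push_cast at hb h2
  set x : ℝ := k + s + r a with hx
  set x' : ℝ := k + (s + j) + r a' with hx'
  have hx'0 : 0 ≤ x' - 1 := by linarith
  have hb2 : v a' * (x' - 1) ≤ v a * x := hb.trans h1
  have h3 : v a * (x + j) ≤ v a' * x' := by
    refine le_trans (le_of_eq ?_) h2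
    rw [hx]; ring
  have h4 : v a * ((x + j) * (x' - 1)) ≤ v a * (x * x') := by
    calc v a * ((x + j) * (x' - 1)) = v a * (x + j) * (x' - 1) := by ring
      _ ≤ v a' * x' * (x' - 1) := by gcongr
      _ = v a' * (x' - 1) * x' := by ring
      _ ≤ v a * x * x' := by gcongr
      _ = _ := by ring
  have h5 := le_of_mul_le_mul_left h4 ha
  have h6 : (j : ℝ) * (x' - 1) ≤ x := by nlinarith
  have h7 : (k : ℝ) + s ≤ x' - 1 := by linarith
  have h8 : (18 : ℝ) * (k + s) ≤ j * (x' - 1) := by gcongr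
  linarith

open Classical in
/-- If ties are concentrated on few values of a binomial variable, and each tie is followed by
wins only, then ties are much rarer than wins, up to a small error. -/
lemma sum_choose_tie_le {tie win : ℕ → Prop} {c : ℕ} {g : ℝ} (hg : 1 ≤ g)
    (hc : 24 * g ^ 2 ≤ √c) (htw : ∀ s s', tie s → s < s' → win s')
    (hgap : ∀ s j, tie s → tie (s + j) → c ≤ 4 * s → j ≤ 17) :
    ∑ t ∈ (Finset.range (c + 1)).filter tie, (c.choose t : ℝ) ≤
      1728 * g / √c * ∑ t ∈ (Finset.range (c + 1)).filter win, (c.choose t : ℝ) +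
        (4 / c + 36 / (g ^ 3 * √c)) * 2 ^ c := by
  have hg0 : 0 < g := by linarith
  have hr0 : 0 < √(c : ℝ) := by nlinarith
  have hc0 : (0 : ℝ) < c := Real.sqrt_pos.1 hr0
  rw [← Finset.sum_filter_add_sum_filter_not _ (fun t => 4 * t < c)]
  -- The gap bound needs s ≥ c/4; smaller values have proportion at most 4/c by Chebyshev.
  have h1 : ∑ t ∈ ((Finset.range (c + 1)).filter tie).filter (fun t => 4 * t < c),
      (c.choose t : ℝ) ≤ 4 / c * 2 ^ c := by
    refine (sum_choose_far_le c (y := c / 2) (by positivity) _ fun t ht => ?_).trans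
      (le_of_eq (by field_simp; ring))
    have h := (Finset.mem_filter.1 ht).2
    have h' : 4 * (t : ℝ) < c := by exact_mod_cast h
    rw [abs_sub_comm]
    exact le_trans (by linarith) (le_abs_self _)
  set A := ((Finset.range (c + 1)).filter tie).filter (fun t => ¬4 * t < c) with hA
  set W := ∑ t ∈ (Finset.range (c + 1)).filter win, (c.choose t : ℝ)
  have hW : 0 ≤ W := Finset.sum_nonneg fun _ _ => by positivity
  have h2 : ∑ t ∈ A, (c.choose t : ℝ) ≤ 18 * (96 * g / √c * W + 2 / (g ^ 3 * √c) * 2 ^ c) := by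
    rcases A.eq_empty_or_nonempty with h0 | hne
    · rw [h0, Finset.sum_empty]; positivity
    · obtain ⟨t₁, ht₁, hmin⟩ := A.exists_min_image id hne
      have hA' : ∀ t ∈ A, tie t ∧ c ≤ 4 * t := fun t ht => by
        simp only [hA, Finset.mem_filter, not_lt] at ht
        exact ⟨ht.1.2, ht.2⟩
      -- The remaining ties fit in 18 consecutive values, whence 1728 = 18 · 96 and 36 = 18 · 2.
      have hcard : A.card ≤ 18 := by
        have : A ⊆ Finset.Icc t₁ (t₁ + 17) := fun t ht => by
          have h3 : t₁ ≤ t := hmin t ht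
          obtain ⟨j, rfl⟩ := Nat.exists_eq_add_of_le h3
          have := hgap t₁ j (hA' _ ht₁).1 (hA' _ ht).1 (hA' _ ht₁).2
          exact Finset.mem_Icc.2 ⟨by omega, by omega⟩
        have := Finset.card_le_card this
        rw [Nat.card_Icc] at this
        omega
      have hterm : ∀ t ∈ A, (c.choose t : ℝ) ≤ 96 * g / √c * W + 2 / (g ^ 3 * √c) * 2 ^ c := by
        intro t ht
        refine (choose_le_tail hg hc t).trans ?_
        gcongr
        refine Finset.sum_le_sum_of_subset_of_nonneg (fun s hs => ?_) fun _ _ _ => by positivity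
        obtain ⟨hs1, hs2⟩ := Finset.mem_Ioc.1 hs
        exact Finset.mem_filter.2 ⟨Finset.mem_range.2 (by omega), htw t s (hA' t ht).1 hs1⟩
      refine (Finset.sum_le_card_nsmul A _ _ hterm).trans ?_
      rw [nsmul_eq_mul]
      gcongr
      exact_mod_cast hcard
  refine (add_le_add h1 h2).trans (le_of_eq ?_)
  ring

end Lines

/-! ### Redistributing the two neighbours of a block -/

section Blocks

variable {κ : Type*} [LinearOrder κ] {n : ℕ}

/-- The rank of user `a` when users are sorted by block first, and by decreasing value within each
block. Here `B` assigns users to blocks, and `φ a j` is the value of user `a` in block `j`. -/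
noncomputable def blockRank (φ : Fin n → κ → ℝ) (B : Fin n → κ) (a : Fin n) : ℕ :=
  (Finset.univ.filter fun b => B b < B a ∨ (B b = B a ∧ φ a (B a) ≤ φ b (B b))).card

/-- The revenue from selling to `a` and to all users ranked before `a`. -/
noncomputable def blockRevenue (φ : Fin n → κ → ℝ) (B : Fin n → κ) (a : Fin n) : ℝ :=
  φ a (B a) * blockRank φ B a

/-- The best price lies in block `mid`, and a price outside the blocks `lo`, ..., `hi` is almost
as good. -/
def NearTie (φ : Fin n → κ → ℝ) (lo mid hi : κ) (B : Fin n → κ) : Prop :=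
  ∃ a, B a = mid ∧ 0 < φ a (B a) ∧ (∀ b, blockRevenue φ B b ≤ blockRevenue φ B a) ∧
    ∃ b, (B b < lo ∨ hi < B b) ∧ φ a (B a) * ((blockRank φ B a : ℝ) - 1) ≤ blockRevenue φ B b

/-- Some price in block `mid` is better than all those outside the blocks `lo`, ..., `hi`. -/
def BlockWins (φ : Fin n → κ → ℝ) (lo mid hi : κ) (B : Fin n → κ) : Prop :=
  ∃ a, B a = mid ∧ ∀ b, B b < lo ∨ hi < B b → blockRevenue φ B b < blockRevenue φ B a

/-- The reassignment of the users of the blocks `lo` and `hi`: those of `T` go to `lo`, the others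
to `hi`. -/
def reassign (lo hi : κ) (B : Fin n → κ) (T : Finset (Fin n)) (a : Fin n) : κ :=
  if B a = lo ∨ B a = hi then if a ∈ T then lo else hi else B a

/-- The users in block `lo` or `hi`. -/
def outerUsers (lo hi : κ) (B : Fin n → κ) : Finset (Fin n) :=
  Finset.univ.filter fun a => B a = lo ∨ B a = hi

variable {lo mid hi : κ} {φ : Fin n → κ → ℝ} {B : Fin n → κ} {T : Finset (Fin n)}

lemma reassign_of_ne {a : Fin n} (h1 : B a ≠ lo) (h2 : B a ≠ hi) :
    reassign lo hi B T a = B a := by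
  simp [reassign, h1, h2]

lemma reassign_eq_iff {a : Fin n} (h1 : mid ≠ lo) (h2 : mid ≠ hi) :
    reassign lo hi B T a = mid ↔ B a = mid := by
  unfold reassign
  split_ifs with h3 h4
  · refine ⟨fun h => absurd h.symm h1, fun h => ?_⟩
    rcases h3 with h3 | h3
    · exact absurd (h.symm.trans h3) h1
    · exact absurd (h.symm.trans h3) h2
  · refine ⟨fun h => absurd h.symm h2, fun h => ?_⟩
    rcases h3 with h3 | h3
    · exact absurd (h.symm.trans h3) h1
    · exact absurd (h.symm.trans h3) h2
  · exact Iff.rfl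

/-- Seen from a block beyond `lo` and `hi`, a user of either one is on the same side, whichever of
the two it is in. -/
lemma blockRank_reassign_of_outside (hlm : lo < mid) (hmh : mid < hi) {a : Fin n}
    (ha : B a < lo ∨ hi < B a) :
    blockRank φ (reassign lo hi B T) a = blockRank φ B a := by
  have h1 : B a ≠ lo := by rintro h; rcases ha with ha | ha
                           · exact ha.ne h
                           · exact (hlm.trans (hmh.trans ha)).ne' h
  have h2 : B a ≠ hi := by rintro h; rcases ha with ha | ha
                           · exact (ha.trans (hlm.trans hmh)).ne h
                           · exact ha.ne' h
  unfold blockRank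
  congr 1
  ext b
  simp only [Finset.mem_filter, Finset.mem_univ, true_and]
  rw [reassign_of_ne h1 h2]
  by_cases hb : B b = lo ∨ B b = hi
  · have e : ∀ j, (j = lo ∨ j = hi) → ((j < B a ∨ (j = B a ∧ φ a (B a) ≤ φ b j)) ↔ hi < B a) := by
      rintro j (rfl | rfl)
      · rcases ha with ha | ha
        · simp [ha.not_gt, h1.symm, (ha.trans (hlm.trans hmh)).not_gt]
        · simp [ha, (hlm.trans (hmh.trans ha))]
      · simp [h2.symm]
    rw [e _ hb, e]
    unfold reassign
    rw [if_pos hb]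
    split_ifs <;> simp
  · rw [not_or] at hb
    rw [reassign_of_ne hb.1 hb.2]

/-- Users sent to `lo` all precede `mid` and those sent to `hi` all follow it, so `T` enters only
through its size. This makes the revenues in `mid` linear in a binomial variable. -/
lemma blockRank_reassign_of_mid (hlm : lo < mid) (hmh : mid < hi)
    (hcov : ∀ j, j < lo ∨ j = lo ∨ j = mid ∨ j = hi ∨ hi < j)
    (hT : T ⊆ outerUsers lo hi B) {a : Fin n} (ha : B a = mid) :
    blockRank φ (reassign lo hi B T) a = (Finset.univ.filter fun b => B b < lo).card + T.card +
      (Finset.univ.filter fun b => B b = mid ∧ φ a mid ≤ φ b mid).card := by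
  have hra : reassign lo hi B T a = mid := (reassign_eq_iff hlm.ne' hmh.ne).2 ha
  unfold blockRank
  rw [hra, ← Finset.card_union_of_disjoint, ← Finset.card_union_of_disjoint]
  · congr 1
    ext b
    simp only [Finset.mem_filter, Finset.mem_univ, true_and, Finset.mem_union]
    have hTb : b ∈ T → B b = lo ∨ B b = hi := fun h => (Finset.mem_filter.1 (hT h)).2
    rcases hcov (B b) with h | h | h | h | h
    · have h1 : B b ≠ lo := h.ne
      have h2 : B b ≠ hi := (h.trans (hlm.trans hmh)).ne
      rw [reassign_of_ne h1 h2]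
      simp [h, h.trans hlm]
    · by_cases hbT : b ∈ T <;> simp [reassign, h, hbT, hlm, hlm.ne, hmh.ne', hmh.not_gt]
    · have h1 : B b ≠ lo := h ▸ hlm.ne'
      have h2 : B b ≠ hi := h ▸ hmh.ne
      have hbT : b ∉ T := fun hb => (hTb hb).elim h1 h2
      rw [reassign_of_ne h1 h2]
      simp [h, hlm.not_gt, hbT]
    · by_cases hbT : b ∈ T <;>
        simp [reassign, h, hbT, hlm, hmh.ne', hmh.not_gt, (hlm.trans hmh).not_gt]
    · have h1 : B b ≠ lo := (hlm.trans (hmh.trans h)).ne'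
      have h2 : B b ≠ hi := h.ne'
      have hbT : b ∉ T := fun hb => (hTb hb).elim h1 h2
      rw [reassign_of_ne h1 h2]
      simp [hbT, (hlm.trans (hmh.trans h)).not_gt, (hmh.trans h).not_gt, (hmh.trans h).ne']
  · rw [Finset.disjoint_left]
    intro b hb hb'
    rw [Finset.mem_union] at hb
    have h' := (Finset.mem_filter.1 hb').2.1
    rcases hb with hb | hb
    · have := (Finset.mem_filter.1 hb).2
      rw [h'] at this
      exact absurd this hlm.not_gt
    · rcases (Finset.mem_filter.1 (hT hb)).2 with h | h
      · exact hlm.ne (h.symm.trans h')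
      · exact hmh.ne' (h.symm.trans h')
  · rw [Finset.disjoint_left]
    intro b hb hb'
    have h1 := (Finset.mem_filter.1 hb).2
    rcases (Finset.mem_filter.1 (hT hb')).2 with h | h
    · exact absurd h h1.ne
    · exact absurd h (h1.trans (hlm.trans hmh)).ne

open Classical in
/-- Among the reassignments of the outer users, near ties are rarer than wins. -/
lemma card_reassign_nearTie_le (hlm : lo < mid) (hmh : mid < hi)
    (hcov : ∀ j, j < lo ∨ j = lo ∨ j = mid ∨ j = hi ∨ hi < j) {g : ℝ} (hg : 1 ≤ g)
    (hc : 24 * g ^ 2 ≤ √((outerUsers lo hi B).card : ℝ))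
    (hm : (Finset.univ.filter fun b => B b = mid).card ≤ 4 * (outerUsers lo hi B).card) :
    (((outerUsers lo hi B).powerset.filter
      fun T => NearTie φ lo mid hi (reassign lo hi B T)).card : ℝ) ≤
      1728 * g / √((outerUsers lo hi B).card : ℝ) * ((outerUsers lo hi B).powerset.filter
        fun T => BlockWins φ lo mid hi (reassign lo hi B T)).card +
      (4 / ((outerUsers lo hi B).card : ℝ) + 36 / (g ^ 3 * √((outerUsers lo hi B).card : ℝ))) *
        2 ^ (outerUsers lo hi B).card := by
  set S := outerUsers lo hi B with hS
  set k := (Finset.univ.filter fun b => B b < lo).card with hk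
  -- Slopes and offsets of the lines come from the users of `mid`; the levels are the revenues
  -- beyond `lo` and `hi`, which no reassignment changes.
  let v : {a // B a = mid} → ℝ := fun a => φ a mid
  let r : {a // B a = mid} → ℕ :=
    fun a => (Finset.univ.filter fun b => B b = mid ∧ φ a mid ≤ φ b mid).card
  let Z : {b // B b < lo ∨ hi < B b} → ℝ := fun b => blockRevenue φ B b
  have hmid : ∀ T ∈ S.powerset, ∀ a, B a = mid → reassign lo hi B T a = mid := fun T _ a ha =>
    (reassign_eq_iff hlm.ne' hmh.ne).2 ha
  have hout : ∀ T b, (B b < lo ∨ hi < B b) → reassign lo hi B T b = B b := by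
    intro T b hb
    refine reassign_of_ne ?_ ?_ <;> rintro h <;> rcases hb with hb | hb
    · exact hb.ne h
    · exact (hlm.trans (hmh.trans hb)).ne' h
    · exact (hb.trans (hlm.trans hmh)).ne h
    · exact hb.ne' h
  have hout' : ∀ T b, (reassign lo hi B T b < lo ∨ hi < reassign lo hi B T b) ↔
      (B b < lo ∨ hi < B b) := by
    intro T b
    refine ⟨fun h => ?_, fun h => by rwa [hout T b h]⟩
    by_cases hb : B b = lo ∨ B b = hi
    · unfold reassign at h
      rw [if_pos hb] at h
      split_ifs at h
      · simp [(hlm.trans hmh).not_gt] at h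
      · simp [(hlm.trans hmh).not_gt] at h
    · rw [not_or] at hb
      rwa [reassign_of_ne hb.1 hb.2] at h
  have hrevm : ∀ T ∈ S.powerset, ∀ a (ha : B a = mid), blockRevenue φ (reassign lo hi B T) a =
      v ⟨a, ha⟩ * (k + T.card + r ⟨a, ha⟩ : ℝ) := by
    intro T hT a ha
    rw [blockRevenue, hmid T hT a ha,
      blockRank_reassign_of_mid hlm hmh hcov (Finset.mem_powerset.1 hT) ha]
    push_cast
    rfl
  have hrevo : ∀ T b, (B b < lo ∨ hi < B b) → blockRevenue φ (reassign lo hi B T) b =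
      blockRevenue φ B b := by
    intro T b hb
    rw [blockRevenue, hout T b hb, blockRank_reassign_of_outside hlm hmh hb, blockRevenue]
  have htie : ∀ T ∈ S.powerset, NearTie φ lo mid hi (reassign lo hi B T) →
      TieAt v r k Z T.card := by
    rintro T hT ⟨a, ha, hpos, hmax, b, hb, hab⟩
    have ha' : B a = mid := (reassign_eq_iff hlm.ne' hmh.ne).1 ha
    rw [hmid T hT a ha'] at hpos hab
    rw [hout'] at hb
    refine ⟨⟨a, ha'⟩, hpos, fun a' => ?_, fun b' => ?_, ⟨b, hb⟩, ?_⟩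
    · rw [← hrevm T hT a ha', ← hrevm T hT a' a'.2]
      exact hmax a'
    · rw [← hrevm T hT a ha']
      exact (hrevo T b' b'.2).symm.le.trans (hmax b')
    · rw [blockRank_reassign_of_mid hlm hmh hcov (Finset.mem_powerset.1 hT) ha',
        hrevo T b hb] at hab
      push_cast at hab
      exact hab
  have hwin : ∀ T ∈ S.powerset, WinsAt v r k Z T.card →
      BlockWins φ lo mid hi (reassign lo hi B T) := by
    rintro T hT ⟨⟨a, ha⟩, h⟩
    refine ⟨a, hmid T hT a ha, fun b hb => ?_⟩
    rw [hout'] at hb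
    rw [hrevo T b hb, hrevm T hT a ha]
    exact h ⟨b, hb⟩
  have hcount : ∀ p : ℕ → Prop, ((S.powerset.filter fun T => p T.card).card : ℝ) =
      ∑ t ∈ (Finset.range (S.card + 1)).filter p, (S.card.choose t : ℝ) := by
    intro p
    rw [Finset.card_filter]
    push_cast
    rw [Finset.sum_powerset_apply_card (fun t => if p t then (1 : ℝ) else 0), Finset.sum_filter]
    refine Finset.sum_congr rfl fun t _ => ?_
    split_ifs <;> simp
  have hS0 : 0 < S.card := by
    have : 0 < √(S.card : ℝ) := by nlinarith
    exact_mod_cast Real.sqrt_pos.1 this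
  have main := sum_choose_tie_le (tie := TieAt v r k Z) (win := WinsAt v r k Z) hg hc
    (fun s s' h hs => h.winsAt hs) (fun s j h h' hs => h.gap_le h' (by omega) fun a => by
      -- The offset is at most the size of `mid`, hence at most 4c ≤ 16s when s ≥ c/4.
      have : r a ≤ (Finset.univ.filter fun b => B b = mid).card :=
        Finset.card_le_card fun b hb => by
          simp only [Finset.mem_filter, Finset.mem_univ, true_and] at hb ⊢
          exact hb.1
      omega)
  rw [← hcount, ← hcount] at main
  have hle1 : ((S.powerset.filter fun T => NearTie φ lo mid hi (reassign lo hi B T)).card : ℝ) ≤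
      (S.powerset.filter fun T => TieAt v r k Z T.card).card := by
    exact_mod_cast Finset.card_le_card fun T hT => by
      rw [Finset.mem_filter] at hT ⊢
      exact ⟨hT.1, htie T hT.1 hT.2⟩
  have hle2 : ((S.powerset.filter fun T => WinsAt v r k Z T.card).card : ℝ) ≤
      (S.powerset.filter fun T => BlockWins φ lo mid hi (reassign lo hi B T)).card := by
    exact_mod_cast Finset.card_le_card fun T hT => by
      rw [Finset.mem_filter] at hT ⊢
      exact ⟨hT.1, hwin T hT.1 hT.2⟩
  refine hle1.trans (main.trans ?_)
  gcongr

open Classical in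
/-- The assignments that differ from `B` by the places of its outer users only are its
reassignments. -/
lemma card_reassign_fiber [Fintype κ] (hlh : lo ≠ hi) (p : (Fin n → κ) → Prop) :
    (Finset.univ.filter fun B' : Fin n → κ => p B' ∧
      reassign lo hi B' Finset.univ = reassign lo hi B Finset.univ).card =
    ((outerUsers lo hi B).powerset.filter fun T => p (reassign lo hi B T)).card := by
  symm
  refine Finset.card_bij (fun T _ => reassign lo hi B T) ?_ ?_ ?_
  · intro T hT
    rw [Finset.mem_filter] at hT ⊢
    refine ⟨Finset.mem_univ _, hT.2, ?_⟩
    ext a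
    by_cases h : B a = lo ∨ B a = hi <;> by_cases hT : a ∈ T <;> simp [reassign, h, hT]
  · intro T hT T' hT' h
    rw [Finset.mem_filter, Finset.mem_powerset] at hT hT'
    have key : ∀ T ⊆ outerUsers lo hi B, ∀ a, a ∈ T ↔
        (B a = lo ∨ B a = hi) ∧ reassign lo hi B T a = lo := by
      intro T hT a
      by_cases ha : a ∈ T
      · have := (Finset.mem_filter.1 (hT ha)).2
        simp [ha, this, reassign]
      · by_cases h : B a = lo ∨ B a = hi <;> simp [ha, h, reassign, hlh.symm]
    ext a
    rw [key T hT.1, key T' hT'.1]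
    rw [show reassign lo hi B T = reassign lo hi B T' from h]
  · intro B' hB'
    obtain ⟨-, hp, he⟩ := Finset.mem_filter.1 hB'
    have hT : reassign lo hi B ((outerUsers lo hi B).filter fun a => B' a = lo) = B' := by
      ext a
      have ha := congrFun he a
      by_cases h : B a = lo ∨ B a = hi <;> by_cases h' : B' a = lo ∨ B' a = hi
      · rcases h' with h' | h'
        · simp [reassign, outerUsers, h, h']
        · simp [reassign, outerUsers, h, h', hlh.symm]
      · simp only [reassign, h, h', Finset.mem_univ, if_true, if_false] at ha
        exact absurd (Or.inl ha) h'
      · simp only [reassign, h, h', Finset.mem_univ, if_true, if_false] at ha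
        exact absurd (Or.inl ha.symm) h
      · simp only [reassign, h, h', Finset.mem_univ, if_true, if_false] at ha ⊢
        exact ha.symm
    refine ⟨(outerUsers lo hi B).filter fun a => B' a = lo, ?_, hT⟩
    rw [Finset.mem_filter, Finset.mem_powerset]
    exact ⟨Finset.filter_subset _ _, by rwa [hT]⟩

open Classical in
/-- Among all assignments for which the blocks `lo` and `hi` are not too small, near ties are
rarer than wins. -/
lemma card_nearTie_le [Fintype κ] (hlm : lo < mid) (hmh : mid < hi)
    (hcov : ∀ j, j < lo ∨ j = lo ∨ j = mid ∨ j = hi ∨ hi < j) {g c₀ : ℝ} (hg : 1 ≤ g)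
    (hc : 24 * g ^ 2 ≤ √c₀) :
    ((Finset.univ.filter fun B : Fin n → κ => (c₀ ≤ (outerUsers lo hi B).card ∧
      (Finset.univ.filter fun b => B b = mid).card ≤ 4 * (outerUsers lo hi B).card) ∧
        NearTie φ lo mid hi B).card : ℝ) ≤
      1728 * g / √c₀ * (Finset.univ.filter fun B : Fin n → κ => BlockWins φ lo mid hi B).card +
      (4 / c₀ + 36 / (g ^ 3 * √c₀)) * (Fintype.card (Fin n → κ) : ℝ) := by
  have hg0 : 0 < g := by linarith
  have hr0 : 0 < √c₀ := by nlinarith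
  have hc0 : 0 < c₀ := Real.sqrt_pos.1 hr0
  -- Partition the assignments into classes under redistribution; sending all outer users to `lo`
  -- gives a canonical label of the class.
  rw [← Finset.card_univ (α := Fin n → κ),
    Finset.card_eq_sum_card_fiberwise (f := fun B => reassign lo hi B Finset.univ)
      (s := Finset.univ.filter fun B : Fin n → κ => (c₀ ≤ (outerUsers lo hi B).card ∧ _) ∧ _)
      (t := Finset.univ) (fun _ _ => Finset.mem_coe.2 (Finset.mem_univ _)),
    Finset.card_eq_sum_card_fiberwise (f := fun B => reassign lo hi B Finset.univ)
      (s := Finset.univ.filter fun B : Fin n → κ => BlockWins φ lo mid hi B)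
      (t := Finset.univ) (fun _ _ => Finset.mem_coe.2 (Finset.mem_univ _)),
    Finset.card_eq_sum_card_fiberwise (f := fun B => reassign lo hi B Finset.univ)
      (s := (Finset.univ : Finset (Fin n → κ)))
      (t := Finset.univ) (fun _ _ => Finset.mem_coe.2 (Finset.mem_univ _))]
  push_cast
  rw [Finset.mul_sum, Finset.mul_sum, ← Finset.sum_add_distrib]
  refine Finset.sum_le_sum fun B₀ _ => ?_
  simp only [Finset.filter_filter]
  -- One member of a class with the size conditions suffices, because its reassignments exhaust the
  -- class.
  rcases Finset.eq_empty_or_nonempty (Finset.univ.filter fun B : Fin n → κ =>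
    ((c₀ ≤ (outerUsers lo hi B).card ∧ (Finset.univ.filter fun b => B b = mid).card ≤
      4 * (outerUsers lo hi B).card) ∧ NearTie φ lo mid hi B) ∧
        reassign lo hi B Finset.univ = B₀) with h0 | ⟨B, hB⟩
  · rw [h0, Finset.card_empty, Nat.cast_zero]
    positivity
  · obtain ⟨-, ⟨⟨hcB, hmB⟩, -⟩, rfl⟩ := Finset.mem_filter.1 hB
    have hlh := (hlm.trans hmh).ne
    have hsq : √c₀ ≤ √((outerUsers lo hi B).card : ℝ) := Real.sqrt_le_sqrt hcB
    have main := card_reassign_nearTie_le (φ := φ) hlm hmh hcov hg (hc.trans hsq) hmB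
    rw [← card_reassign_fiber hlh, ← card_reassign_fiber hlh] at main
    have hall : ((Finset.univ.filter fun B' : Fin n → κ =>
        reassign lo hi B' Finset.univ = reassign lo hi B Finset.univ).card : ℝ) =
        2 ^ (outerUsers lo hi B).card := by
      have := card_reassign_fiber (B := B) hlh fun _ => True
      simp only [true_and, Finset.filter_true, Finset.card_powerset] at this
      exact_mod_cast this
    rw [hall]
    refine le_trans ?_ (main.trans ?_)
    · exact_mod_cast Finset.card_le_card fun B' hB' => by
        rw [Finset.mem_filter] at hB' ⊢
        exact ⟨hB'.1, hB'.2.1.2, hB'.2.2⟩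
    · gcongr

end Blocks

/-! ### Close competitors, and block ranks as demands -/

section CloseCompetitor

variable {n : ℕ}

/-- At least `J` users pay the monopolistic price, and a lower price that sells to about `J` more
users yields almost the same revenue. -/
def CloseCompetitor (v : Fin n → ℝ≥0) (J : ℝ) : Prop :=
  J ≤ bidCount v (monopolyPrice v) ∧ ∃ q < monopolyPrice v,
    (monopolyPrice v : ℝ) * ((bidCount v (monopolyPrice v) : ℝ) - 1) ≤ q * bidCount v q ∧
    (bidCount v (monopolyPrice v) : ℝ) + J - 1 ≤ bidCount v q

lemma closeCompetitor_of_lt_discountRatio {v : Fin n → ℝ≥0} {i : Fin n} {J : ℝ} (hJ : 0 ≤ J)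
    (h : J < bidCount v (monopolyPrice v) * monopolisticAuction.discountRatio v i) :
    CloseCompetitor v J := by
  set N : ℝ := ((bidCount v (monopolyPrice v) : ℕ) : ℝ)
  have hδ0 := discountRatio_nonneg v i
  have hδ1 := discountRatio_le_one v i
  have hN : 0 < N := by
    rcases (Nat.cast_nonneg _ : (0 : ℝ) ≤ N).eq_or_lt with h0 | h0
    · rw [show N = 0 from h0.symm] at h; linarith
    · exact h0
  have h' : J / N < monopolisticAuction.discountRatio v i := by
    rw [div_lt_iff₀ hN]; linarith
  obtain ⟨q, hq, h1, h2⟩ := exists_near_tie_of_lt_discountRatio v i (by positivity) h'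
  rw [div_mul_cancel₀ _ hN.ne'] at h2
  exact ⟨by nlinarith, q, hq, h1, h2⟩

variable {κ : Type*} [LinearOrder κ] {φ : Fin n → κ → ℝ≥0} {B : Fin n → κ}

/-- Earlier blocks carry values at least as large. Equality can fail when values coincide across
blocks. -/
lemma blockRank_le_bidCount (hφ : ∀ a b i j, i < j → φ b j ≤ φ a i) (a : Fin n) :
    blockRank (fun a i => (φ a i : ℝ)) B a ≤ bidCount (fun a => φ a (B a)) (φ a (B a)) :=
  Finset.card_le_card fun b hb => by
    simp only [Finset.mem_filter, Finset.mem_univ, true_and, NNReal.coe_le_coe] at hb ⊢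
    rcases hb with hb | hb
    · exact hφ _ _ _ _ hb
    · exact hb.2

/-- The buyer ranked last, with the lowest value in the last block that contains a buyer, has all
buyers and nobody else ranked up to it. -/
lemma exists_blockRank_eq_bidCount (hφ : ∀ a b i j, i < j → φ b j ≤ φ a i) {p : ℝ≥0}
    (hp : 0 < bidCount (fun a => φ a (B a)) p) :
    ∃ a, p ≤ φ a (B a) ∧
      blockRank (fun a i => (φ a i : ℝ)) B a = bidCount (fun a => φ a (B a)) p := by
  obtain ⟨a₀, ha₀, hmax⟩ := Finset.exists_max_image
    (Finset.univ.filter fun a => p ≤ φ a (B a)) B (Finset.card_pos.1 hp)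
  obtain ⟨a, ha, hmin⟩ := Finset.exists_min_image
    ((Finset.univ.filter fun a => p ≤ φ a (B a)).filter fun a => B a = B a₀)
    (fun a => φ a (B a)) ⟨a₀, by simpa using ha₀⟩
  simp only [Finset.mem_filter, Finset.mem_univ, true_and] at ha₀ ha hmax hmin
  refine ⟨a, ha.1, le_antisymm ?_ ?_⟩
  · exact (blockRank_le_bidCount hφ a).trans (bidCount_antitone _ ha.1)
  · refine Finset.card_le_card fun b hb => ?_
    simp only [Finset.mem_filter, Finset.mem_univ, true_and, NNReal.coe_le_coe] at hb ⊢
    rcases (hmax b hb).lt_or_eq with h | h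
    · exact Or.inl (ha.2 ▸ h)
    · exact Or.inr ⟨h.trans ha.2.symm, hmin b ⟨hb, h⟩⟩

end CloseCompetitor

/-! ### Counting assignments with a close competitor -/

section Counting

variable {n k : ℕ}

/-- The `l`-th block. -/
def blockLo (l : Fin k) : Fin (k + 2) := ⟨l, by omega⟩

/-- The block after the `l`-th. -/
def blockMid (l : Fin k) : Fin (k + 2) := ⟨l + 1, by omega⟩

/-- The second block after the `l`-th. -/
def blockHi (l : Fin k) : Fin (k + 2) := ⟨l + 2, by omega⟩

lemma block_cover (l : Fin k) (j : Fin (k + 2)) :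
    j < blockLo l ∨ j = blockLo l ∨ j = blockMid l ∨ j = blockHi l ∨ blockHi l < j := by
  simp only [blockLo, blockMid, blockHi, Fin.lt_def, Fin.ext_iff]
  omega

-- If two winning indices differed by at least 2, each middle block would lie outside the window of
-- the other, and the two winning prices would strictly beat each other.
open Classical in
lemma card_blockWins_le_two (φ : Fin n → Fin (k + 2) → ℝ) (B : Fin n → Fin (k + 2)) :
    (Finset.univ.filter fun l : Fin k =>
      BlockWins φ (blockLo l) (blockMid l) (blockHi l) B).card ≤ 2 := by
  set W := Finset.univ.filter fun l : Fin k =>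
    BlockWins φ (blockLo l) (blockMid l) (blockHi l) B with hW
  have key : ∀ l ∈ W, ∀ l' ∈ W, (l' : ℕ) ≤ l + 1 := by
    intro l hl l' hl'
    obtain ⟨a, ha, h⟩ := (Finset.mem_filter.1 hl).2
    obtain ⟨a', ha', h'⟩ := (Finset.mem_filter.1 hl').2
    by_contra hlt
    refine lt_asymm (h a' (Or.inr ?_)) (h' a (Or.inl ?_))
    · rw [ha']; simp only [blockHi, blockMid, Fin.lt_def]; omega
    · rw [ha]; simp only [blockLo, blockMid, Fin.lt_def]; omega
  rcases W.eq_empty_or_nonempty with h0 | hne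
  · simp [h0]
  · obtain ⟨l₀, hl₀, hmin⟩ := W.exists_min_image id hne
    have hsub : W.image (fun l : Fin k => (l : ℕ)) ⊆ Finset.Icc (l₀ : ℕ) (l₀ + 1) := by
      intro x hx
      obtain ⟨l, hl, rfl⟩ := Finset.mem_image.1 hx
      exact Finset.mem_Icc.2 ⟨hmin l hl, key l₀ hl₀ l hl⟩
    have := Finset.card_le_card hsub
    rw [Finset.card_image_of_injective _ Fin.val_injective, Nat.card_Icc] at this
    omega

open Classical in
lemma sum_card_blockWins_le (φ : Fin n → Fin (k + 2) → ℝ) :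
    ∑ l : Fin k, ((Finset.univ.filter fun B : Fin n → Fin (k + 2) =>
      BlockWins φ (blockLo l) (blockMid l) (blockHi l) B).card : ℝ) ≤
      2 * ((k + 2 : ℕ) : ℝ) ^ n := by
  have h : ∑ l : Fin k, (Finset.univ.filter fun B : Fin n → Fin (k + 2) =>
      BlockWins φ (blockLo l) (blockMid l) (blockHi l) B).card ≤ 2 * (k + 2) ^ n := by
    simp only [Finset.card_filter]
    rw [Finset.sum_comm]
    simp only [← Finset.card_filter]
    refine (Finset.sum_le_sum fun B _ => card_blockWins_le_two φ B).trans ?_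
    simp [mul_comm]
  exact_mod_cast h

/-- If all blocks have about the same size, a close competitor causes a near tie between
distant blocks. -/
lemma CloseCompetitor.exists_nearTie {φ : Fin n → Fin (k + 2) → ℝ≥0} {B : Fin n → Fin (k + 2)}
    (hφ : ∀ a b i j, i < j → φ b j ≤ φ a i) (hn : k + 2 ≤ n)
    (hB : ∀ i, |((k + 2 : ℕ) : ℝ) * ((Finset.univ.filter fun a => B a = i).card : ℝ) - n| <
      (n : ℝ) / 2)
    (h : CloseCompetitor (fun a => φ a (B a)) (16 * n / (k + 2 : ℕ))) :
    ∃ l : Fin k, ((n : ℝ) / (k + 2 : ℕ) ≤ (outerUsers (blockLo l) (blockHi l) B).card ∧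
      (Finset.univ.filter fun b => B b = blockMid l).card ≤
        4 * (outerUsers (blockLo l) (blockHi l) B).card) ∧
      NearTie (fun a i => (φ a i : ℝ)) (blockLo l) (blockMid l) (blockHi l) B := by
  set K : ℝ := ((k + 2 : ℕ) : ℝ) with hK
  have hK0 : 0 < K := by positivity
  have hKn : K ≤ n := by rw [hK]; exact_mod_cast hn
  set μ : ℝ := n / K with hμ
  have hμ1 : 1 ≤ μ := by rw [hμ, le_div_iff₀ hK0]; linarith
  have hnμ : (n : ℝ) = K * μ := by rw [hμ]; field_simp
  set v : Fin n → ℝ≥0 := fun a => φ a (B a) with hv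
  set ψ : Fin n → Fin (k + 2) → ℝ := fun a i => (φ a i : ℝ) with hψ
  have hup : ∀ i, ((Finset.univ.filter fun a => B a = i).card : ℝ) ≤ 3 / 2 * μ := by
    intro i
    have h1 := (abs_lt.1 (hB i)).2
    rw [hnμ] at h1
    refine le_of_mul_le_mul_left ?_ hK0
    linarith
  have hlow : ∀ i, μ / 2 ≤ ((Finset.univ.filter fun a => B a = i).card : ℝ) := by
    intro i
    have h1 := (abs_lt.1 (hB i)).1
    rw [hnμ] at h1
    refine le_of_mul_le_mul_left ?_ hK0
    linarith
  obtain ⟨hJ, q, hq, hrev, hJ'⟩ := h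
  set P := monopolyPrice v with hP
  have hJμ : 16 * n / K = 16 * μ := by rw [hμ]; ring
  rw [hJμ] at hJ hJ'
  have hNP : 0 < bidCount v P := by
    have : (0 : ℝ) < bidCount v P := by linarith
    exact_mod_cast this
  have hNq : 0 < bidCount v q := hNP.trans_le (bidCount_antitone v hq.le)
  obtain ⟨a, haP, ha⟩ := exists_blockRank_eq_bidCount hφ hNP
  obtain ⟨b, hbq, hb⟩ := exists_blockRank_eq_bidCount hφ hNq
  -- Otherwise raising the price to the lowest buyer's value would keep all buyers and increase the
  -- revenue.
  have hva : φ a (B a) = P := by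
    refine le_antisymm ?_ haP
    have h1 := revenue_le_monopoly v (φ a (B a))
    have h2 : (bidCount v P : ℝ≥0) ≤ bidCount v (φ a (B a)) := by
      rw [← ha]; exact_mod_cast blockRank_le_bidCount hφ a
    have h3 : φ a (B a) * (bidCount v P : ℝ≥0) ≤ P * bidCount v P :=
      le_trans (by gcongr) h1
    exact le_of_mul_le_mul_right h3 (by exact_mod_cast hNP)
  have hP0 : (0 : ℝ) < P := by exact_mod_cast (zero_le.trans_lt hq : (0 : ℝ≥0) < P)
  have hle_low : ∀ c, (blockRank ψ B c : ℝ) ≤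
      ((Finset.univ.filter fun x => B x < B c).card : ℝ) +
        (Finset.univ.filter fun x => B x = B c).card := by
    intro c
    rw [← Nat.cast_add, Nat.cast_le]
    refine le_trans (Finset.card_le_card fun x hx => ?_) (Finset.card_union_le _ _)
    simp only [Finset.mem_filter, Finset.mem_univ, true_and, Finset.mem_union] at hx ⊢
    exact hx.imp_right And.left
  have hge : ((Finset.univ.filter fun x => B x < B a).card : ℝ) ≤ blockRank ψ B a := by
    rw [Nat.cast_le]
    refine Finset.card_le_card fun x hx => ?_
    simp only [Finset.mem_filter, Finset.mem_univ, true_and] at hx ⊢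
    exact Or.inl hx
  have ha' : (blockRank ψ B a : ℝ) = bidCount v P := by exact_mod_cast ha
  have hb' : (blockRank ψ B b : ℝ) = bidCount v q := by exact_mod_cast hb
  -- At least 16μ users buy, but the first block has at most 3μ/2, so the block of P has a
  -- predecessor.
  have hpos : 0 < (B a : ℕ) := by
    by_contra h0
    have h1 : (Finset.univ.filter fun x => B x < B a) = ∅ := by
      refine Finset.filter_eq_empty_iff.2 fun x _ hx => ?_
      rw [Fin.lt_def] at hx
      omega
    have h2 := hle_low a
    rw [h1, Finset.card_empty, Nat.cast_zero] at h2
    linarith [hup (B a)]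
  -- The competitor sells to at least 16μ - 1 ≥ 15μ more users, whereas ending at most one block
  -- later would add at most two blocks, that is 3μ users.
  have hfar : (B a : ℕ) + 1 < B b := by
    by_contra hle
    push Not at hle
    have hlt : (B a : ℕ) + 1 < k + 2 ∨ (B b : ℕ) ≤ B a := by omega
    have h2 : ((Finset.univ.filter fun x => B x < B b).card : ℝ) ≤
        (Finset.univ.filter fun x => B x < B a).card +
          (Finset.univ.filter fun x => B x = B a).card := by
      rw [← Nat.cast_add, Nat.cast_le]
      refine le_trans (Finset.card_le_card fun x hx => ?_) (Finset.card_union_le _ _)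
      simp only [Finset.mem_filter, Finset.mem_univ, true_and, Finset.mem_union, Fin.lt_def,
        Fin.ext_iff] at hx ⊢
      omega
    linarith [hle_low b, hup (B b), hup (B a)]
  obtain ⟨l, hl⟩ : ∃ l : Fin k, (l : ℕ) + 1 = B a := ⟨⟨(B a : ℕ) - 1, by omega⟩, by simp; omega⟩
  have hmid : B a = blockMid l := by rw [Fin.ext_iff]; exact hl.symm
  have houter : ((outerUsers (blockLo l) (blockHi l) B).card : ℝ) =
      (Finset.univ.filter fun x => B x = blockLo l).card +
        (Finset.univ.filter fun x => B x = blockHi l).card := by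
    rw [outerUsers, Finset.filter_or, Finset.card_union_of_disjoint, Nat.cast_add]
    rw [Finset.disjoint_left]
    intro x hx hx'
    have h1 := (Finset.mem_filter.1 hx).2.symm.trans (Finset.mem_filter.1 hx').2
    simp [blockLo, blockHi, Fin.ext_iff] at h1
  have hrevb : (q : ℝ) * bidCount v q ≤ blockRevenue ψ B b := by
    rw [blockRevenue, hb']
    have : (q : ℝ) ≤ ψ b (B b) := by exact_mod_cast hbq
    gcongr
  have hψa : ψ a (B a) = P := by rw [← hva]
  refine ⟨l, ⟨?_, ?_⟩, a, hmid, ?_, fun c => ?_, b, Or.inr ?_, ?_⟩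
  · rw [houter]; linarith [hlow (blockLo l), hlow (blockHi l)]
  · rw [← Nat.cast_le (α := ℝ)]
    push_cast
    rw [houter]
    linarith [hlow (blockLo l), hlow (blockHi l), hup (blockMid l)]
  · rw [hψa]; exact hP0
  · have h1 : (φ c (B c) : ℝ) * bidCount v (φ c (B c)) ≤ P * bidCount v P := by
      exact_mod_cast revenue_le_monopoly v (φ c (B c))
    rw [blockRevenue, blockRevenue, hψa, ha']
    refine le_trans ?_ h1
    have : (blockRank ψ B c : ℝ) ≤ bidCount v (φ c (B c)) := by
      exact_mod_cast blockRank_le_bidCount hφ c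
    exact mul_le_mul_of_nonneg_left this (NNReal.coe_nonneg _)
  · rw [Fin.lt_def]; simp only [blockHi]; omega
  · rw [hψa, ha']; exact hrev.trans hrevb

open Classical in
/-- For `n` users that are assigned independently and uniformly to consecutive blocks of values,
a close competitor is unlikely. -/
lemma card_closeCompetitor_le {φ : Fin n → Fin (k + 2) → ℝ≥0}
    (hφ : ∀ a b i j, i < j → φ b j ≤ φ a i) (hn : k + 2 ≤ n) {g : ℝ} (hg : 1 ≤ g)
    (hc : 24 * g ^ 2 ≤ √((n : ℝ) / (k + 2 : ℕ))) :
    ((Finset.univ.filter fun B : Fin n → Fin (k + 2) =>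
      CloseCompetitor (fun a => φ a (B a)) (16 * n / (k + 2 : ℕ))).card : ℝ) ≤
      (8 * ((k + 2 : ℕ) : ℝ) ^ 2 / n + 3456 * g / √((n : ℝ) / (k + 2 : ℕ)) +
        36 * (k + 2 : ℕ) / (g ^ 3 * √((n : ℝ) / (k + 2 : ℕ)))) * ((k + 2 : ℕ) : ℝ) ^ n := by
  set K : ℝ := ((k + 2 : ℕ) : ℝ) with hK
  have hK0 : 0 < K := by positivity
  have hn0 : 0 < n := by omega
  have hn' : (0 : ℝ) < n := by exact_mod_cast hn0
  have hg0 : 0 < g := by linarith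
  set c₀ : ℝ := (n : ℝ) / K with hc₀
  have hc0 : 0 < c₀ := by positivity
  set ψ : Fin n → Fin (k + 2) → ℝ := fun a i => (φ a i : ℝ)
  let D : Fin (k + 2) → Finset (Fin n → Fin (k + 2)) := fun i => Finset.univ.filter fun B =>
    (n : ℝ) / 2 ≤ |K * ((Finset.univ.filter fun a => B a = i).card : ℝ) - n|
  let E : Fin k → Finset (Fin n → Fin (k + 2)) := fun l => Finset.univ.filter fun B =>
    (c₀ ≤ (outerUsers (blockLo l) (blockHi l) B).card ∧
      (Finset.univ.filter fun b => B b = blockMid l).card ≤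
        4 * (outerUsers (blockLo l) (blockHi l) B).card) ∧
      NearTie ψ (blockLo l) (blockMid l) (blockHi l) B
  have hsub : (Finset.univ.filter fun B : Fin n → Fin (k + 2) =>
      CloseCompetitor (fun a => φ a (B a)) (16 * n / K)) ⊆
      Finset.univ.biUnion D ∪ Finset.univ.biUnion E := by
    intro B hB
    have hB' := (Finset.mem_filter.1 hB).2
    rw [Finset.mem_union]
    by_cases hD : ∃ i, B ∈ D i
    · obtain ⟨i, hi⟩ := hD
      exact Or.inl (Finset.mem_biUnion.2 ⟨i, Finset.mem_univ _, hi⟩)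
    · push Not at hD
      obtain ⟨l, hl⟩ := hB'.exists_nearTie hφ hn fun i => by
        have := hD i
        simpa only [D, Finset.mem_filter, Finset.mem_univ, true_and, not_le] using this
      exact Or.inr (Finset.mem_biUnion.2 ⟨l, Finset.mem_univ _, Finset.mem_filter.2
        ⟨Finset.mem_univ _, hl⟩⟩)
  have h1 : ((Finset.univ.filter fun B : Fin n → Fin (k + 2) =>
      CloseCompetitor (fun a => φ a (B a)) (16 * n / K)).card : ℝ) ≤
      ∑ i, ((D i).card : ℝ) + ∑ l, ((E l).card : ℝ) := by
    have := (Finset.card_le_card hsub).trans ((Finset.card_union_le _ _).trans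
      (add_le_add Finset.card_biUnion_le Finset.card_biUnion_le))
    exact_mod_cast this
  have h2 : ∑ i, ((D i).card : ℝ) ≤ K * (4 * K / n * K ^ n) := by
    refine (Finset.sum_le_sum fun i _ => card_class_deviates_le n hn0 i).trans (le_of_eq ?_)
    simp [hK]
  have h3 : ∑ l, ((E l).card : ℝ) ≤ 1728 * g / √c₀ * (2 * K ^ n) +
      K * ((4 / c₀ + 36 / (g ^ 3 * √c₀)) * K ^ n) := by
    have hlm : ∀ l : Fin k, blockLo l < blockMid l := fun l => by
      simp [blockLo, blockMid, Fin.lt_def]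
    have hmh : ∀ l : Fin k, blockMid l < blockHi l := fun l => by
      simp [blockHi, blockMid, Fin.lt_def]
    refine (Finset.sum_le_sum fun l _ => card_nearTie_le (φ := ψ) (hlm l) (hmh l)
      (block_cover l) hg hc).trans ?_
    rw [Finset.sum_add_distrib, ← Finset.mul_sum]
    gcongr
    -- Only the error term is multiplied by the number of blocks; the wins over all blocks total at
    -- most twice the number of assignments.
    · exact sum_card_blockWins_le ψ
    · simp only [Finset.sum_const, Finset.card_univ, Fintype.card_fin, nsmul_eq_mul,
        Fintype.card_pi, Finset.prod_const]
      push_cast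
      rw [hK]
      push_cast
      gcongr
      linarith
  refine h1.trans ((add_le_add h2 h3).trans (le_of_eq ?_))
  rw [hc₀]
  field_simp
  ring

end Counting

/-! ### Sampling a value through quantile blocks -/

section Quantile

/-- The upper quantile function of a law on `[0, ∞)`: the least `x` that is exceeded with
probability at most `u`. -/
noncomputable def upperQuantile (F : Measure ℝ≥0) (u : ℝ) : ℝ≥0 :=
  sInf {x : ℝ≥0 | F.real (Set.Ioi x) ≤ u}

variable (F : Measure ℝ≥0) [IsProbabilityMeasure F]

lemma exists_measureReal_Ioi_le {u : ℝ} (hu : 0 < u) : ∃ x : ℝ≥0, F.real (Set.Ioi x) ≤ u := by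
  have h : Tendsto (fun m : ℕ => F (Set.Ioi (m : ℝ≥0))) atTop
      (𝓝 (F (⋂ m : ℕ, Set.Ioi (m : ℝ≥0)))) := by
    refine tendsto_measure_iInter_atTop (fun m => measurableSet_Ioi.nullMeasurableSet) ?_
      ⟨0, measure_ne_top _ _⟩
    intro a b hab
    exact Set.Ioi_subset_Ioi (by exact_mod_cast hab)
  have h0 : (⋂ m : ℕ, Set.Ioi (m : ℝ≥0)) = ∅ := by
    refine Set.eq_empty_of_forall_notMem fun x hx => ?_
    obtain ⟨m, hm⟩ := exists_nat_gt x
    exact absurd (Set.mem_iInter.1 hx m) (not_lt.2 hm.le)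
  rw [h0, measure_empty] at h
  obtain ⟨m, hm⟩ := (h.eventually (gt_mem_nhds (ENNReal.ofReal_pos.2 hu))).exists
  exact ⟨m, ENNReal.toReal_le_of_le_ofReal hu.le hm.le⟩

/-- The tail of F is right-continuous, so the infimum is attained; u > 0 makes the set non-empty. -/
lemma upperQuantile_le_iff {u : ℝ} (hu : 0 < u) (x : ℝ≥0) :
    upperQuantile F u ≤ x ↔ F.real (Set.Ioi x) ≤ u := by
  refine ⟨fun h => ?_, fun h => csInf_le (OrderBot.bddBelow _) h⟩
  have hgt : ∀ m : ℕ, F.real (Set.Ioi (x + 1 / ((m : ℝ≥0) + 1))) ≤ u := by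
    intro m
    have hlt : upperQuantile F u < x + 1 / ((m : ℝ≥0) + 1) :=
      h.trans_lt (lt_add_of_pos_right _ (by positivity))
    have hne : {x : ℝ≥0 | F.real (Set.Ioi x) ≤ u}.Nonempty :=
      let ⟨x, hx⟩ := exists_measureReal_Ioi_le F hu
      ⟨x, hx⟩
    obtain ⟨y, hy, hyx⟩ := exists_lt_of_csInf_lt hne hlt
    exact (measureReal_mono (Set.Ioi_subset_Ioi hyx.le)).trans hy
  have hU : Set.Ioi x = ⋃ m : ℕ, Set.Ioi (x + 1 / ((m : ℝ≥0) + 1)) := by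
    ext y
    simp only [Set.mem_Ioi, Set.mem_iUnion]
    constructor
    · intro hxy
      obtain ⟨m, hm⟩ := exists_nat_one_div_lt (show (0 : ℝ≥0) < y - x from tsub_pos_of_lt hxy)
      exact ⟨m, lt_tsub_iff_left.1 hm⟩
    · rintro ⟨m, hm⟩
      exact lt_of_le_of_lt (le_add_of_nonneg_right zero_le) hm
  have hT : Tendsto (fun m : ℕ => F (Set.Ioi (x + 1 / ((m : ℝ≥0) + 1)))) atTop
      (𝓝 (F (Set.Ioi x))) := by
    rw [hU]
    refine tendsto_measure_iUnion_atTop ?_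
    intro a b hab
    refine Set.Ioi_subset_Ioi ?_
    have : (a : ℝ≥0) ≤ b := by exact_mod_cast hab
    gcongr
  have hT' := (ENNReal.tendsto_toReal (measure_ne_top F (Set.Ioi x))).comp hT
  exact le_of_tendsto' hT' hgt

lemma upperQuantile_antitone {u u' : ℝ} (hu : 0 < u) (h : u ≤ u') :
    upperQuantile F u' ≤ upperQuantile F u :=
  (upperQuantile_le_iff F (hu.trans_le h) _).2 (((upperQuantile_le_iff F hu _).1 le_rfl).trans h)

/-- The uniform law on `Fin K`. -/
noncomputable def uniformFin (K : ℕ) : Measure (Fin K) := (K : ENNReal)⁻¹ • Measure.count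

instance (K : ℕ) [NeZero K] : IsProbabilityMeasure (uniformFin K) := by
  constructor
  simp only [uniformFin, Measure.smul_apply, Measure.count_univ, ENat.card_eq_coe_fintype_card,
    Fintype.card_fin, smul_eq_mul]
  exact ENNReal.inv_mul_cancel (by simpa using NeZero.ne K) (by simp)

/-- The uniform law on `(0, 1]`. -/
noncomputable def uniformUnit : Measure ℝ := volume.restrict (Set.Ioc 0 1)

instance : IsProbabilityMeasure uniformUnit := by
  constructor
  simp [uniformUnit]

/-- A value in block `i` of `K`: the upper quantile at a point `w` of `(0, 1]`, rescaled to the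
`i`-th interval of length `1 / K`. -/
noncomputable def blockValue (F : Measure ℝ≥0) (K : ℕ) (x : Fin K × ℝ) : ℝ≥0 :=
  upperQuantile F ((x.1 + if x.2 ∈ Set.Ioc (0 : ℝ) 1 then x.2 else 1) / K)

/-- Replacing points outside (0, 1] by 1 makes the order of the blocks hold for all w, not just
almost all, so the counting bound applies for every fixed family of points. -/
lemma blockValue_le {K : ℕ} {i j : Fin K} (hij : i < j) (w w' : ℝ) :
    blockValue F K (j, w') ≤ blockValue F K (i, w) := by
  have hK : (0 : ℝ) < K := by exact_mod_cast i.pos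
  have ht : ∀ w : ℝ, (if w ∈ Set.Ioc (0 : ℝ) 1 then w else 1) ∈ Set.Ioc (0 : ℝ) 1 := by
    intro w; split_ifs with h
    · exact h
    · simp
  have hij' : (i : ℝ) + 1 ≤ j := by exact_mod_cast hij
  have h1 := ht w
  have h2 := ht w'
  unfold blockValue
  refine upperQuantile_antitone F (div_pos ?_ hK) ?_
  · exact add_pos_of_nonneg_of_pos (Nat.cast_nonneg _) h1.1
  · refine div_le_div_of_nonneg_right ?_ hK.le
    dsimp only
    linarith [h1.2, h2.1]

lemma blockValue_le_iff {K : ℕ} (i : Fin K) (w : ℝ) (x : ℝ≥0) :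
    blockValue F K (i, w) ≤ x ↔
      K * F.real (Set.Ioi x) - i ≤ if w ∈ Set.Ioc (0 : ℝ) 1 then w else 1 := by
  have hK : (0 : ℝ) < K := by exact_mod_cast i.pos
  have ht : (0 : ℝ) < if w ∈ Set.Ioc (0 : ℝ) 1 then w else 1 := by
    split_ifs with h
    · exact h.1
    · simp
  have hu : (0 : ℝ) < (i + if w ∈ Set.Ioc (0 : ℝ) 1 then w else 1) / K :=
    div_pos (add_pos_of_nonneg_of_pos (Nat.cast_nonneg _) ht) hK
  unfold blockValue
  rw [upperQuantile_le_iff F hu, le_div_iff₀ hK, mul_comm, sub_le_iff_le_add']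

lemma measurable_blockValue (K : ℕ) : Measurable (blockValue F K) := by
  refine measurable_of_Iic fun x => ?_
  have : blockValue F K ⁻¹' Set.Iic x = {p : Fin K × ℝ | (K : ℝ) * F.real (Set.Ioi x) - p.1 ≤
      if p.2 ∈ Set.Ioc (0 : ℝ) 1 then p.2 else 1} := by
    ext ⟨i, w⟩
    exact blockValue_le_iff F i w x
  rw [this]
  refine measurableSet_le ?_ ?_
  · exact measurable_const.sub
      ((measurable_of_countable fun i : Fin K => (i : ℝ)).comp measurable_fst)
  · exact Measurable.ite (measurable_snd measurableSet_Ioc) measurable_snd measurable_const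

/-- The difference of minima is chosen to telescope when s runs through Ky - i over the blocks i. -/
lemma uniformUnit_real_ge (s : ℝ) :
    uniformUnit.real {w | s ≤ if w ∈ Set.Ioc (0 : ℝ) 1 then w else 1} =
      1 - (min s 1 - min s 0) := by
  have hm : MeasurableSet {w : ℝ | s ≤ if w ∈ Set.Ioc (0 : ℝ) 1 then w else 1} :=
    measurableSet_le measurable_const
      (Measurable.ite measurableSet_Ioc measurable_id measurable_const)
  have hinter : {w : ℝ | s ≤ if w ∈ Set.Ioc (0 : ℝ) 1 then w else 1} ∩ Set.Ioc 0 1 =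
      Set.Ici s ∩ Set.Ioc 0 1 := by
    ext w
    simp only [Set.mem_inter_iff, Set.mem_ofPred_eq, Set.mem_Ici]
    constructor
    · rintro ⟨h, hw⟩; rw [if_pos hw] at h; exact ⟨h, hw⟩
    · rintro ⟨h, hw⟩; rw [if_pos hw]; exact ⟨h, hw⟩
  rw [measureReal_def, uniformUnit, Measure.restrict_apply hm, hinter]
  rcases le_or_gt s 0 with h | h
  · have : Set.Ici s ∩ Set.Ioc (0 : ℝ) 1 = Set.Ioc 0 1 :=
      Set.inter_eq_right.2 fun w hw => h.trans hw.1.le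
    rw [this, Real.volume_Ioc, min_eq_left h, min_eq_left (h.trans zero_le_one)]
    simp
  · have : Set.Ici s ∩ Set.Ioc (0 : ℝ) 1 = Set.Icc s 1 := by
      ext w
      simp only [Set.mem_inter_iff, Set.mem_Ici, Set.mem_Ioc, Set.mem_Icc]
      exact ⟨fun hw => ⟨hw.1, hw.2.2⟩, fun hw => ⟨hw.1, h.trans_le hw.1, hw.2⟩⟩
    rw [this, Real.volume_Icc, min_eq_right h.le]
    rcases le_total s 1 with h1 | h1
    · rw [ENNReal.toReal_ofReal (by linarith), min_eq_left h1]; ring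
    · rw [ENNReal.ofReal_of_nonpos (by linarith), min_eq_right h1]; simp

/-- A block chosen uniformly, and then a uniform point of that block, produce a value with
law `F`. -/
lemma map_blockValue (K : ℕ) [NeZero K] :
    ((uniformFin K).prod uniformUnit).map (blockValue F K) = F := by
  have hK : (0 : ℝ) < K := by exact_mod_cast Nat.pos_of_ne_zero (NeZero.ne K)
  have : IsProbabilityMeasure (((uniformFin K).prod uniformUnit).map (blockValue F K)) :=
    Measure.isProbabilityMeasure_map (measurable_blockValue F K).aemeasurable
  refine Measure.ext_of_Iic _ _ fun x => ?_
  set y := F.real (Set.Ioi x) with hy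
  have hy0 : 0 ≤ y := measureReal_nonneg
  have hy1 : y ≤ 1 := measureReal_le_one
  have hm := measurable_blockValue F K (measurableSet_Iic (a := x))
  rw [← ENNReal.toReal_eq_toReal_iff' (measure_ne_top _ _) (measure_ne_top _ _),
    Measure.map_apply (measurable_blockValue F K) measurableSet_Iic, Measure.prod_apply hm,
    uniformFin, lintegral_smul_measure, lintegral_count, tsum_fintype]
  have hsec : ∀ i : Fin K, Prod.mk i ⁻¹' (blockValue F K ⁻¹' Set.Iic x) =
      {w | K * y - i ≤ if w ∈ Set.Ioc (0 : ℝ) 1 then w else 1} := by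
    intro i
    ext w
    exact blockValue_le_iff F i w x
  simp only [hsec, smul_eq_mul]
  rw [ENNReal.toReal_mul, ENNReal.toReal_sum fun i _ => measure_ne_top _ _]
  simp only [← measureReal_def, uniformUnit_real_ge]
  have htel : ∑ i : Fin K, (1 - (min (K * y - i) 1 - min (K * y - i) 0)) = K - K * y := by
    have h1 : ∀ i : ℕ, min (K * y - i) 1 - min (K * y - i) 0 =
        min (K * y) ((i + 1 : ℕ) : ℝ) - min (K * y) (i : ℝ) := by
      intro i
      have e1 : min (K * y - i) 1 = min (K * y) ((i + 1 : ℕ) : ℝ) - i := by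
        rw [← min_sub_sub_right]; push_cast; congr 1; ring
      have e2 : min (K * y - i) 0 = min (K * y) (i : ℝ) - i := by
        rw [← min_sub_sub_right, sub_self]
      rw [e1, e2]; ring
    rw [Finset.sum_sub_distrib, Fin.sum_univ_eq_sum_range
      (fun i : ℕ => min (K * y - i) 1 - min (K * y - i) 0), Finset.sum_congr rfl fun i _ => h1 i,
      Finset.sum_range_sub (fun i : ℕ => min (K * y) (i : ℝ))]
    rw [min_eq_left (by nlinarith), Nat.cast_zero, min_eq_right (by positivity)]
    simp
  rw [htel]
  have hF : F.real (Set.Iic x) = 1 - y := by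
    rw [hy, ← Set.compl_Iic, measureReal_compl measurableSet_Iic, probReal_univ]; ring
  rw [hF, ENNReal.toReal_inv, ENNReal.toReal_natCast]
  field_simp

end Quantile

/-! ### From counting to i.i.d. values -/

section Probability

open Classical in
lemma pi_uniformFin_le {n K : ℕ} [NeZero K] {p : (Fin n → Fin K) → Prop} {C : ℝ}
    (h : ((Finset.univ.filter p).card : ℝ) ≤ C * (K : ℝ) ^ n) :
    (Measure.pi fun _ : Fin n => uniformFin K) {B | p B} ≤ ENNReal.ofReal C := by
  have hK : (0 : ℝ) < K := by exact_mod_cast Nat.pos_of_ne_zero (NeZero.ne K)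
  have h1 : {B | p B} = ((Finset.univ.filter p : Finset (Fin n → Fin K)) : Set _) := by
    ext; simp
  rw [h1, ← sum_measure_singleton]
  have h2 : ∀ B : Fin n → Fin K, (Measure.pi fun _ : Fin n => uniformFin K) {B} =
      ENNReal.ofReal (((K : ℝ) ^ n)⁻¹) := by
    intro B
    rw [Measure.pi_singleton]
    simp only [uniformFin, Measure.smul_apply, Measure.count_singleton, smul_eq_mul, mul_one,
      Finset.prod_const, Finset.card_univ, Fintype.card_fin]
    rw [ENNReal.ofReal_inv_of_pos (by positivity), ENNReal.ofReal_pow hK.le,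
      ENNReal.ofReal_natCast, ENNReal.inv_pow]
  simp only [h2, Finset.sum_const, nsmul_eq_mul]
  rw [← ENNReal.ofReal_natCast, ← ENNReal.ofReal_mul (by positivity)]
  refine ENNReal.ofReal_le_ofReal ?_
  rwa [← div_eq_mul_inv, div_le_iff₀ (by positivity)]

open Classical in
/-- A bound for all families of values transfers to i.i.d. values. -/
lemma pi_measureReal_le_of_card_le (F : Measure ℝ≥0) [IsProbabilityMeasure F] {n K : ℕ}
    [NeZero K] {E : Set (Fin n → ℝ≥0)} (hE : MeasurableSet E) {C : ℝ} (hC : 0 ≤ C)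
    (h : ∀ φ : Fin n → Fin K → ℝ≥0, (∀ a b i j, i < j → φ b j ≤ φ a i) →
      ((Finset.univ.filter fun B : Fin n → Fin K => (fun a => φ a (B a)) ∈ E).card : ℝ) ≤
        C * (K : ℝ) ^ n) :
    (Measure.pi fun _ : Fin n => F).real E ≤ C := by
  refine ENNReal.toReal_le_of_le_ofReal hC ?_
  have hmeas := measurable_blockValue F K
  have hmap : (Measure.pi fun _ : Fin n => F) =
      (Measure.pi fun _ : Fin n => (uniformFin K).prod uniformUnit).map
        (fun x a => blockValue F K (x a)) := by
    rw [Measure.pi_map_pi (fun _ => hmeas.aemeasurable)]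
    simp only [map_blockValue]
  have hg : Measurable fun (x : Fin n → Fin K × ℝ) a => blockValue F K (x a) :=
    measurable_pi_lambda _ fun a => hmeas.comp (measurable_pi_apply a)
  have hmp := (measurePreserving_arrowProdEquivProdArrow (Fin K) ℝ (Fin n)
    (fun _ => uniformFin K) (fun _ => uniformUnit)).symm
  -- Separate the blocks from the points by Fubini and condition on the points; what remains is a
  -- count over assignments.
  rw [hmap, Measure.map_apply hg hE, ← hmp.measure_preimage_equiv,
    Measure.prod_apply_symm (hmp.measurable (hg hE))]
  refine (lintegral_mono (g := fun _ => ENNReal.ofReal C) fun w => ?_).trans (by simp)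
  exact pi_uniformFin_le (h (fun a i => blockValue F K (i, w a))
    fun a b i j hij => blockValue_le F hij _ _)

end Probability

/-! ### The discount mass has expectation O(1/√n) -/

section DiscountMass

variable {n : ℕ}

lemma discountRatio_le_iSup (v : Fin n → ℝ≥0) (i : Fin n) :
    monopolisticAuction.discountRatio v i ≤ ⨆ j, monopolisticAuction.discountRatio v j :=
  le_ciSup (Set.finite_range _).bddAbove i

lemma iSup_discountRatio_nonneg (v : Fin n → ℝ≥0) :
    0 ≤ ⨆ j, monopolisticAuction.discountRatio v j :=
  Real.iSup_nonneg fun j => discountRatio_nonneg v j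

lemma iSup_discountRatio_le_one (v : Fin n → ℝ≥0) :
    ⨆ j, monopolisticAuction.discountRatio v j ≤ 1 :=
  Real.iSup_le (fun j => discountRatio_le_one v j) zero_le_one

lemma measurable_iSup_discountRatio :
    Measurable fun v : Fin n → ℝ≥0 => ⨆ j, monopolisticAuction.discountRatio v j :=
  Measurable.iSup fun j => measurable_discountRatio j

/-- The largest discount ratio, weighted by the fraction of confirmed users. -/
noncomputable def discountMass (v : Fin n → ℝ≥0) : ℝ :=
  bidCount v (monopolyPrice v) / n * ⨆ j, monopolisticAuction.discountRatio v j

lemma discountMass_nonneg (v : Fin n → ℝ≥0) : 0 ≤ discountMass v :=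
  mul_nonneg (by positivity) (iSup_discountRatio_nonneg v)

lemma discountMass_le_one (v : Fin n → ℝ≥0) : discountMass v ≤ 1 := by
  have h : (bidCount v (monopolyPrice v) : ℝ) / n ≤ 1 :=
    div_le_one_of_le₀ (by exact_mod_cast bidCount_le v _) (Nat.cast_nonneg _)
  exact mul_le_one₀ h (iSup_discountRatio_nonneg v) (iSup_discountRatio_le_one v)

lemma measurable_discountMass : Measurable fun v : Fin n → ℝ≥0 => discountMass v := by
  refine Measurable.mul (Measurable.div_const ?_ _) measurable_iSup_discountRatio
  exact (measurable_from_top (f := fun k : ℕ => (k : ℝ))).comp measurable_bidCount_monopolyPrice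

lemma sum_discountRatio_le (v : Fin n → ℝ≥0) :
    ∑ i, monopolisticAuction.discountRatio v i ≤ n * discountMass v := by
  rcases Nat.eq_zero_or_pos n with rfl | hn
  · simp
  · have hn' : (n : ℝ) ≠ 0 := by positivity
    have h : ∑ i, monopolisticAuction.discountRatio v i ≤
        ∑ i ∈ Finset.univ.filter (fun i => monopolyPrice v ≤ v i),
          ⨆ j, monopolisticAuction.discountRatio v j := by
      rw [Finset.sum_filter]
      refine Finset.sum_le_sum fun i _ => ?_
      split_ifs with hi
      · exact discountRatio_le_iSup v i
      · exact (discountRatio_of_lt v i (not_le.1 hi)).le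
    refine h.trans (le_of_eq ?_)
    rw [Finset.sum_const, nsmul_eq_mul, discountMass, bidCount]
    field_simp

lemma closeCompetitor_of_lt_discountMass {v : Fin n → ℝ≥0} (hn : 0 < n) {η : ℝ} (hη : 0 ≤ η)
    (h : η < discountMass v) : CloseCompetitor v (η * n) := by
  have hn' : (0 : ℝ) < n := by exact_mod_cast hn
  have : Nonempty (Fin n) := ⟨⟨0, hn⟩⟩
  obtain ⟨i, hi⟩ := exists_eq_ciSup_of_finite (f := monopolisticAuction.discountRatio v)
  refine closeCompetitor_of_lt_discountRatio (i := i) (by positivity) ?_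
  rw [discountMass, ← hi, div_mul_eq_mul_div, lt_div_iff₀ hn'] at h
  exact h

/-- With K = 16^(j+2) blocks the threshold 16^(-(j+1)) equals 16/K. The choice g = K^(1/4) balances
g/√c₀ against K/(g³√c₀) for c₀ = n/K: both become g³/√n, and 3456 + 36 = 3492. -/
lemma prob_discountMass_gt_le (F : Measure ℝ≥0) [IsProbabilityMeasure F] (hn : 0 < n) (j : ℕ) :
    (Measure.pi fun _ : Fin n => F).real {v | (1 / 16 : ℝ) ^ (j + 1) < discountMass v} ≤
      576 * 65536 * 256 ^ j / n + 3492 * 64 * 8 ^ j / √n := by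
  have hn' : (0 : ℝ) < n := by exact_mod_cast hn
  have hsn : 0 < √(n : ℝ) := Real.sqrt_pos.2 hn'
  -- Here 576 = 24², and the quantity on the left is 576·g⁸: above n the claimed bound exceeds 1,
  -- below it the condition 24g² ≤ √(n/K) holds.
  by_cases hbig : (576 * 65536 * 256 ^ j : ℝ) ≤ n
  swap
  · have h1 : 1 ≤ (576 * 65536 * 256 ^ j : ℝ) / n := by
      rw [le_div_iff₀ hn']; linarith
    have h2 : 0 ≤ (3492 * 64 * 8 ^ j : ℝ) / √n := by positivity
    exact measureReal_le_one.trans (by linarith)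
  obtain ⟨k, hk⟩ : ∃ k : ℕ, k + 2 = 16 ^ (j + 2) :=
    ⟨16 ^ (j + 2) - 2, by have := Nat.one_le_pow j 16 (by norm_num); rw [pow_add]; omega⟩
  have hK : ((k + 2 : ℕ) : ℝ) = 256 * 16 ^ j := by rw [hk]; push_cast; ring
  set g : ℝ := 4 * 2 ^ j with hg
  have hg1 : 1 ≤ g := by
    have : (1 : ℝ) ≤ 2 ^ j := one_le_pow₀ (by norm_num)
    linarith
  have hg0 : 0 < g := by linarith
  have hp4 : ((2 : ℝ) ^ j) ^ 4 = 16 ^ j := by rw [← pow_mul, mul_comm, pow_mul]; norm_num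
  have hp8 : ((2 : ℝ) ^ j) ^ 8 = 256 ^ j := by rw [← pow_mul, mul_comm, pow_mul]; norm_num
  have hp3 : ((2 : ℝ) ^ j) ^ 3 = 8 ^ j := by rw [← pow_mul, mul_comm, pow_mul]; norm_num
  have hKg : ((k + 2 : ℕ) : ℝ) = g ^ 4 := by rw [hK, hg, mul_pow, hp4]; norm_num
  have hsq : √((n : ℝ) / (k + 2 : ℕ)) = √n / g ^ 2 := by
    rw [Real.sqrt_div hn'.le, hKg, show g ^ 4 = (g ^ 2) ^ 2 by ring, Real.sqrt_sq (by positivity)]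
  have hg8 : 65536 * 256 ^ j = g ^ 8 := by rw [hg, mul_pow, hp8]; norm_num
  have hg3 : 64 * 8 ^ j = g ^ 3 := by rw [hg, mul_pow, hp3]; norm_num
  rw [mul_assoc, hg8] at hbig
  have hc : 24 * g ^ 2 ≤ √((n : ℝ) / (k + 2 : ℕ)) := by
    rw [hsq, le_div_iff₀ (by positivity)]
    refine Real.le_sqrt_of_sq_le (le_trans (le_of_eq ?_) hbig)
    ring
  have hkn : k + 2 ≤ n := by
    rw [← Nat.cast_le (α := ℝ), hKg]
    have : 1 ≤ g ^ 4 := one_le_pow₀ hg1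
    nlinarith
  have hE : MeasurableSet {v : Fin n → ℝ≥0 | (1 / 16 : ℝ) ^ (j + 1) < discountMass v} :=
    measurableSet_lt measurable_const measurable_discountMass
  have hJ : (1 / 16 : ℝ) ^ (j + 1) * n = 16 * n / (k + 2 : ℕ) := by
    rw [hK, one_div, inv_pow, pow_succ]
    field_simp
    norm_num
  refine (pi_measureReal_le_of_card_le F (K := k + 2) hE
    (C := 8 * ((k + 2 : ℕ) : ℝ) ^ 2 / n + 3456 * g / √((n : ℝ) / (k + 2 : ℕ)) +
        36 * (k + 2 : ℕ) / (g ^ 3 * √((n : ℝ) / (k + 2 : ℕ)))) (by positivity)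
    fun φ hφ => ?_).trans ?_
  · classical
    refine le_trans ?_ (card_closeCompetitor_le hφ hkn hg1 hc)
    rw [Nat.cast_le]
    refine Finset.card_le_card fun B hB => ?_
    rw [Finset.mem_filter] at hB ⊢
    refine ⟨hB.1, ?_⟩
    rw [← hJ]
    exact closeCompetitor_of_lt_discountMass hn (by positivity) hB.2
  · rw [hsq, hKg, mul_assoc 576, hg8, mul_assoc 3492, hg3]
    have e : 8 * (g ^ 4) ^ 2 / (n : ℝ) + 3456 * g / (√n / g ^ 2) +
        36 * g ^ 4 / (g ^ 3 * (√n / g ^ 2)) = 8 * g ^ 8 / n + 3492 * g ^ 3 / √n := by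
      field_simp
      ring
    rw [e]
    gcongr
    norm_num

/-- A layer-cake bound along powers of `1 / 16`. -/
lemma le_sum_layers {H : ℝ} (hH : H ≤ 1) (m : ℕ) :
    H ≤ (1 / 16 : ℝ) ^ m + ∑ j ∈ Finset.range m,
      (1 / 16 : ℝ) ^ j * (if (1 / 16 : ℝ) ^ (j + 1) < H then 1 else 0) := by
  induction m with
  | zero => simpa using hH
  | succ m ih =>
    rw [Finset.sum_range_succ]
    have h0 : 0 ≤ ∑ j ∈ Finset.range m,
        (1 / 16 : ℝ) ^ j * (if (1 / 16 : ℝ) ^ (j + 1) < H then 1 else 0) := by positivity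
    have h1 : 0 < (1 / 16 : ℝ) ^ (m + 1) := by positivity
    have h2 : 0 < (1 / 16 : ℝ) ^ m := by positivity
    split_ifs with h
    · linarith
    · push Not at h; linarith

lemma integrable_of_measurable_of_mem_Icc {Ω : Type*} [MeasurableSpace Ω] {μ : Measure Ω}
    [IsProbabilityMeasure μ] {f : Ω → ℝ} (hf : Measurable f) (h0 : ∀ x, 0 ≤ f x)
    (h1 : ∀ x, f x ≤ 1) : Integrable f μ :=
  Integrable.of_bound hf.aestronglyMeasurable 1 (ae_of_all _ fun x => by
    rw [Real.norm_of_nonneg (h0 x)]; exact h1 x)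

lemma integrable_discountMass (F : Measure ℝ≥0) [IsProbabilityMeasure F] :
    Integrable (fun v : Fin n → ℝ≥0 => discountMass v) (Measure.pi fun _ => F) :=
  integrable_of_measurable_of_mem_Icc measurable_discountMass discountMass_nonneg
    discountMass_le_one

/-- The expected discount mass is `O(1 / √n)`, uniformly in the law of the values. -/
lemma exists_integral_discountMass_le : ∃ C : ℝ, 0 ≤ C ∧ ∀ (F : Measure ℝ≥0)
    [IsProbabilityMeasure F] (n : ℕ), 0 < n →
      ∫ v : Fin n → ℝ≥0, discountMass v ∂(Measure.pi fun _ => F) ≤ C / √n := by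
  refine ⟨16 + 576 * 65536 + 3492 * 64 * 2, by norm_num, fun F _ n hn => ?_⟩
  have hn' : (1 : ℝ) ≤ n := by exact_mod_cast hn
  have hn0 : (0 : ℝ) < n := by linarith
  have hs1 : 1 ≤ √(n : ℝ) := Real.one_le_sqrt.2 hn'
  have hs0 : 0 < √(n : ℝ) := by linarith
  have hss : √(n : ℝ) * √n = n := Real.mul_self_sqrt (by linarith)
  -- The layers stop at 16^(-m), of order 1/√n. Up to there, the terms in 1/n grow like 16^j and
  -- total O(√n/n), while those in 1/√n decay like 2^(-j).
  obtain ⟨m, hm1, hm2⟩ := exists_nat_pow_near hs1 (show (1 : ℝ) < 16 by norm_num)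
  set μ := Measure.pi fun _ : Fin n => F with hμ
  let E : ℕ → Set (Fin n → ℝ≥0) := fun j => {v | (1 / 16 : ℝ) ^ (j + 1) < discountMass v}
  have hE : ∀ j, MeasurableSet (E j) := fun j =>
    measurableSet_lt measurable_const measurable_discountMass
  have hint : ∀ j, Integrable (fun v => (1 / 16 : ℝ) ^ j * (E j).indicator 1 v) μ := fun j =>
    ((integrable_const (1 : ℝ)).indicator (hE j)).const_mul _
  have h1 : ∫ v, discountMass v ∂μ ≤ ∫ v, ((1 / 16 : ℝ) ^ m +
      ∑ j ∈ Finset.range m, (1 / 16 : ℝ) ^ j * (E j).indicator 1 v) ∂μ := by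
    refine integral_mono (integrable_discountMass F)
      ((integrable_const _).add (integrable_finsetSum _ fun j _ => hint j)) fun v => ?_
    refine (le_sum_layers (discountMass_le_one v) m).trans (le_of_eq ?_)
    simp only [E, Set.indicator_apply, Set.mem_ofPred_eq, Pi.one_apply]
  refine h1.trans ?_
  rw [integral_add (integrable_const _) (integrable_finsetSum _ fun j _ => hint j),
    integral_finsetSum _ fun j _ => hint j]
  simp only [integral_const, probReal_univ, smul_eq_mul, one_mul, integral_const_mul,
    integral_indicator_one (hE _)]
  have hterm : ∀ j ∈ Finset.range m, (1 / 16 : ℝ) ^ j * μ.real (E j) ≤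
      576 * 65536 / n * 16 ^ j + 3492 * 64 / √n * (1 / 2) ^ j := by
    intro j _
    have h := prob_discountMass_gt_le F hn j
    have e1 : (1 / 16 : ℝ) ^ j * 256 ^ j = 16 ^ j := by rw [← mul_pow]; norm_num
    have e2 : (1 / 16 : ℝ) ^ j * 8 ^ j = (1 / 2) ^ j := by rw [← mul_pow]; norm_num
    calc (1 / 16 : ℝ) ^ j * μ.real (E j)
        ≤ (1 / 16 : ℝ) ^ j * (576 * 65536 * 256 ^ j / n + 3492 * 64 * 8 ^ j / √n) := by gcongr
      _ = 576 * 65536 / n * ((1 / 16 : ℝ) ^ j * 256 ^ j) +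
          3492 * 64 / √n * ((1 / 16 : ℝ) ^ j * 8 ^ j) := by ring
      _ = _ := by rw [e1, e2]
  have hsum := Finset.sum_le_sum hterm
  rw [Finset.sum_add_distrib, ← Finset.mul_sum, ← Finset.mul_sum] at hsum
  have g1 : ∑ j ∈ Finset.range m, (16 : ℝ) ^ j ≤ 16 ^ m := by
    rw [geom_sum_eq (by norm_num)]
    have : (0 : ℝ) < 16 ^ m := by positivity
    rw [div_le_iff₀ (by norm_num)]
    linarith
  have g2 : ∑ j ∈ Finset.range m, (1 / 2 : ℝ) ^ j ≤ 2 := by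
    have := sum_geometric_two_le m
    simpa using this
  have a1 : (1 / 16 : ℝ) ^ m ≤ 16 / √n := by
    rw [one_div, inv_pow, le_div_iff₀ hs0, inv_mul_le_iff₀ (by positivity)]
    rw [pow_succ] at hm2
    linarith
  have a2 : 576 * 65536 / (n : ℝ) * ∑ j ∈ Finset.range m, (16 : ℝ) ^ j ≤ 576 * 65536 / √n := by
    calc 576 * 65536 / (n : ℝ) * ∑ j ∈ Finset.range m, (16 : ℝ) ^ j
        ≤ 576 * 65536 / (n : ℝ) * √n := by gcongr; exact g1.trans hm1
      _ = 576 * 65536 / √n := by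
        rw [div_mul_eq_mul_div, div_eq_div_iff hn0.ne' hs0.ne', mul_assoc, hss]
  have a3 : 3492 * 64 / √(n : ℝ) * ∑ j ∈ Finset.range m, (1 / 2 : ℝ) ^ j ≤
      3492 * 64 / √n * 2 := by gcongr
  have e : (16 + 576 * 65536 + 3492 * 64 * 2 : ℝ) / √n =
      16 / √n + 576 * 65536 / √n + 3492 * 64 / √n * 2 := by ring
  rw [e]
  linarith

end DiscountMass

/-! ### The average discount ratio -/

section Average

variable {n : ℕ}

lemma integrable_discountRatio (F : Measure ℝ≥0) [IsProbabilityMeasure F] (i : Fin n) :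
    Integrable (fun v : Fin n → ℝ≥0 => monopolisticAuction.discountRatio v i)
      (Measure.pi fun _ => F) :=
  integrable_of_measurable_of_mem_Icc (measurable_discountRatio i)
    (fun v => discountRatio_nonneg v i) fun v => discountRatio_le_one v i

lemma integrable_iSup_discountRatio (F : Measure ℝ≥0) [IsProbabilityMeasure F] :
    Integrable (fun v : Fin n → ℝ≥0 => ⨆ j, monopolisticAuction.discountRatio v j)
      (Measure.pi fun _ => F) :=
  integrable_of_measurable_of_mem_Icc measurable_iSup_discountRatio iSup_discountRatio_nonneg
    iSup_discountRatio_le_one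

/-- By symmetry, all users have the same expected discount ratio. -/
lemma integral_discountRatio_eq (F : Measure ℝ≥0) [IsProbabilityMeasure F] (i j : Fin n) :
    ∫ v : Fin n → ℝ≥0, monopolisticAuction.discountRatio v i ∂(Measure.pi fun _ => F) =
      ∫ v : Fin n → ℝ≥0, monopolisticAuction.discountRatio v j ∂(Measure.pi fun _ => F) := by
  have hmp := measurePreserving_piCongrLeft (fun _ : Fin n => F) (Equiv.swap i j)
  rw [← hmp.integral_comp' fun v => monopolisticAuction.discountRatio v i]
  refine integral_congr_ae (ae_of_all _ fun v => ?_)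
  have : MeasurableEquiv.piCongrLeft (fun _ => ℝ≥0) (Equiv.swap i j) v = v ∘ Equiv.swap i j := by
    ext a
    obtain ⟨b, rfl⟩ := (Equiv.swap i j).surjective a
    rw [MeasurableEquiv.coe_piCongrLeft, Equiv.piCongrLeft_apply_apply]
    simp
  dsimp only
  rw [this, discountRatio_comp_perm, Equiv.swap_apply_left]

/-- By exchangeability, n times the left side is the expected sum of all discounts, to which only
confirmed users contribute. -/
lemma integral_discountRatio_le (F : Measure ℝ≥0) [IsProbabilityMeasure F] (i : Fin n) :
    ∫ v : Fin n → ℝ≥0, monopolisticAuction.discountRatio v i ∂(Measure.pi fun _ => F) ≤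
      ∫ v : Fin n → ℝ≥0, discountMass v ∂(Measure.pi fun _ => F) := by
  have hn : (0 : ℝ) < n := by exact_mod_cast i.pos
  refine le_of_mul_le_mul_left ?_ hn
  calc (n : ℝ) * ∫ v : Fin n → ℝ≥0, monopolisticAuction.discountRatio v i ∂(Measure.pi fun _ => F)
      = ∑ j, ∫ v : Fin n → ℝ≥0, monopolisticAuction.discountRatio v j ∂(Measure.pi fun _ => F) := by
        rw [Finset.sum_congr rfl fun j _ => integral_discountRatio_eq F j i]
        simp
    _ = ∫ v : Fin n → ℝ≥0, ∑ j, monopolisticAuction.discountRatio v j ∂(Measure.pi fun _ => F) :=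
        (integral_finsetSum _ fun j _ => integrable_discountRatio F j).symm
    _ ≤ ∫ v : Fin n → ℝ≥0, n * discountMass v ∂(Measure.pi fun _ => F) :=
        integral_mono (integrable_finsetSum _ fun j _ => integrable_discountRatio F j)
          ((integrable_discountMass F).const_mul _) sum_discountRatio_le
    _ = _ := integral_const_mul _ _

lemma avgDiscountRatio_isBigO (F : Measure ℝ≥0) [IsProbabilityMeasure F] :
    (monopolisticAuction.avgDiscountRatio F) =O[atTop] (fun n : ℕ => 1 / √(n : ℝ)) := by
  obtain ⟨C, hC, h⟩ := exists_integral_discountMass_le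
  refine IsBigO.of_bound C (eventually_atTop.2 ⟨1, fun n hn => ?_⟩)
  obtain ⟨n, rfl⟩ := Nat.exists_eq_add_of_le' hn
  have h0 : 0 ≤ monopolisticAuction.avgDiscountRatio F (n + 1) :=
    integral_nonneg fun v => discountRatio_nonneg v 0
  rw [Real.norm_of_nonneg h0, Real.norm_of_nonneg (by positivity), mul_one_div]
  exact (integral_discountRatio_le F 0).trans (h F (n + 1) (Nat.succ_pos n))

end Average

/-! ### The maximal discount ratio for bounded support -/

section BoundedSupport

variable {n : ℕ}

/-- The demand at a price that is accepted with probability `τ` is at least half of its mean,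
except with probability `O(1 / n)`. -/
lemma prob_bidCount_lt_le (F : Measure ℝ≥0) [IsProbabilityMeasure F] (hn : 0 < n) {t : ℝ≥0}
    (ht : 0 < F.real (Set.Ici t)) :
    (Measure.pi fun _ : Fin n => F).real
      {v | (bidCount v t : ℝ) < F.real (Set.Ici t) / 2 * n} ≤
        4 / F.real (Set.Ici t) ^ 2 / n := by
  set τ := F.real (Set.Ici t) with hτ
  have hn' : (0 : ℝ) < n := by exact_mod_cast hn
  set μ := Measure.pi fun _ : Fin n => F with hμ
  let f : ℝ≥0 → ℝ := (Set.Ici t).indicator 1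
  have hf : Measurable f := measurable_one.indicator measurableSet_Ici
  let X : Fin n → (Fin n → ℝ≥0) → ℝ := fun i v => f (v i)
  have hX : ∀ i, Measurable (X i) := fun i => hf.comp (measurable_pi_apply i)
  have hf0 : ∀ x, 0 ≤ f x := fun x => Set.indicator_nonneg (fun _ _ => zero_le_one) x
  have hf1 : ∀ x, f x ≤ 1 := fun x => Set.indicator_le_self' (fun _ _ => zero_le_one) x
  have hL : ∀ i, MemLp (X i) 2 μ := fun i =>
    MemLp.of_bound (hX i).aestronglyMeasurable 1 (ae_of_all _ fun v => by
      rw [Real.norm_of_nonneg (hf0 _)]; exact hf1 _)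
  have hmean : ∀ i, ∫ v, X i v ∂μ = τ := by
    intro i
    have hev : Measurable fun v : Fin n → ℝ≥0 => v i := measurable_pi_apply i
    have : μ.map (fun v : Fin n → ℝ≥0 => v i) = F :=
      (measurePreserving_eval (fun _ : Fin n => F) i).map_eq
    calc ∫ v, X i v ∂μ = ∫ x, f x ∂(μ.map fun v : Fin n → ℝ≥0 => v i) :=
          (integral_map hev.aemeasurable hf.aestronglyMeasurable).symm
      _ = τ := by rw [this]; exact integral_indicator_one measurableSet_Ici
  have hind : ProbabilityTheory.iIndepFun X μ :=
    ProbabilityTheory.iIndepFun_pi (X := fun _ => f) fun _ => hf.aemeasurable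
  have hvar : ProbabilityTheory.variance (∑ i, X i) μ ≤ n := by
    rw [ProbabilityTheory.IndepFun.variance_sum (fun i _ => hL i)
      fun i _ j _ hij => hind.indepFun hij]
    calc ∑ i, ProbabilityTheory.variance (X i) μ ≤ ∑ i : Fin n, (1 : ℝ) := by
          refine Finset.sum_le_sum fun i _ => ?_
          refine (ProbabilityTheory.variance_le_expectation_sq (hX i).aestronglyMeasurable).trans ?_
          calc ∫ v, (X i ^ 2) v ∂μ ≤ ∫ _, (1 : ℝ) ∂μ := by
                refine integral_mono (hL i).integrable_sq (integrable_const _) fun v => ?_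
                exact pow_le_one₀ (hf0 _) (hf1 _)
            _ = 1 := by simp
      _ = n := by simp
  have hS : ∀ v : Fin n → ℝ≥0, (∑ i, X i) v = bidCount v t := by
    intro v
    rw [Finset.sum_apply, bidCount, Finset.card_filter]
    push_cast
    refine Finset.sum_congr rfl fun i _ => ?_
    simp [X, f, Set.indicator_apply]
  have hES : ∫ v, (∑ i, X i) v ∂μ = n * τ := by
    simp only [Finset.sum_apply]
    rw [integral_finsetSum _ fun i _ => (hL i).integrable (by norm_num)]
    simp [hmean]
  have hcheb := ProbabilityTheory.meas_ge_le_variance_div_sq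
    (memLp_finsetSum' Finset.univ fun i _ => hL i) (show 0 < τ / 2 * n by positivity)
  have hsub : {v : Fin n → ℝ≥0 | (bidCount v t : ℝ) < τ / 2 * n} ⊆
      {v | τ / 2 * n ≤ |(∑ i, X i) v - ∫ v, (∑ i, X i) v ∂μ|} := by
    intro v hv
    rw [Set.mem_ofPred_eq] at hv ⊢
    rw [hES, hS, abs_sub_comm]
    exact le_trans (by linarith) (le_abs_self _)
  refine (measureReal_mono hsub).trans ((ENNReal.toReal_le_of_le_ofReal
    (div_nonneg (ProbabilityTheory.variance_nonneg _ _) (sq_nonneg _)) hcheb).trans ?_)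
  calc ProbabilityTheory.variance (∑ i, X i) μ / (τ / 2 * n) ^ 2 ≤ n / (τ / 2 * n) ^ 2 := by gcongr
    _ = 4 / τ ^ 2 / n := by field_simp; norm_num

lemma iSup_discountRatio_eq_zero {v : Fin n → ℝ≥0} (h : ∀ i, v i ≤ 0) :
    ⨆ j, monopolisticAuction.discountRatio v j = 0 := by
  have hP : monopolyPrice v = 0 := le_antisymm (monopolyPrice_le_of_forall_le h) zero_le
  have h0 : ∀ j, monopolisticAuction.discountRatio v j = 0 := fun j => by
    rw [discountRatio_of_le v j (by rw [hP]; exact zero_le), hP]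
    simp
  simp [h0]

lemma ae_le_of_measure_Ioi_eq_zero (F : Measure ℝ≥0) [IsProbabilityMeasure F] {D : ℝ≥0}
    (hD : F (Set.Ioi D) = 0) : ∀ᵐ v ∂(Measure.pi fun _ : Fin n => F), ∀ i, v i ≤ D := by
  rw [ae_all_iff]
  intro i
  have h : ∀ᵐ x ∂F, x ≤ D := by
    rw [ae_iff, show {x | ¬x ≤ D} = Set.Ioi D by ext; simp]
    exact hD
  exact (measurePreserving_eval (fun _ : Fin n => F) i).quasiMeasurePreserving.ae h

/-- Unless F is the point mass at 0, some price t > 0 is accepted with probability τ > 0. Typically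
it earns at least tτn/2, and since P ≤ D almost surely this forces N/n ≥ tτ/(2D). Dividing the
discount mass by this constant bounds the maximum. -/
lemma exists_integral_iSup_le (F : Measure ℝ≥0) [IsProbabilityMeasure F] {D : ℝ≥0}
    (hD : F (Set.Ioi D) = 0) : ∃ C : ℝ, ∀ n : ℕ, 0 < n →
      ∫ v : Fin n → ℝ≥0, (⨆ j, monopolisticAuction.discountRatio v j)
        ∂(Measure.pi fun _ => F) ≤ C / √n := by
  by_cases h0 : F (Set.Ioi 0) = 0
  · refine ⟨0, fun n _ => le_of_eq ?_⟩
    rw [zero_div]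
    refine integral_eq_zero_of_ae ?_
    filter_upwards [ae_le_of_measure_Ioi_eq_zero F h0] with v hv
    exact iSup_discountRatio_eq_zero hv
  obtain ⟨t, ht0, ht⟩ : ∃ t : ℝ≥0, 0 < t ∧ 0 < F.real (Set.Ici t) := by
    by_contra hcon
    push Not at hcon
    refine h0 ?_
    have hU : Set.Ioi (0 : ℝ≥0) ⊆ ⋃ m : ℕ, Set.Ici (1 / ((m : ℝ≥0) + 1)) := by
      intro x hx
      obtain ⟨m, hm⟩ := exists_nat_one_div_lt (show (0 : ℝ≥0) < x from hx)
      exact Set.mem_iUnion.2 ⟨m, hm.le⟩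
    refine measure_mono_null hU (measure_iUnion_null fun m => ?_)
    have := hcon (1 / ((m : ℝ≥0) + 1)) (by positivity)
    exact (measureReal_eq_zero_iff).1 (le_antisymm this measureReal_nonneg)
  have hD0 : 0 < D := by
    rcases eq_zero_or_pos D with h | h
    · exact absurd (h ▸ hD) h0
    · exact h
  obtain ⟨C, hC, hmass⟩ := exists_integral_discountMass_le
  set τ := F.real (Set.Ici t) with hτ
  have hDr : (0 : ℝ) < D := by exact_mod_cast hD0
  have htr : (0 : ℝ) < t := by exact_mod_cast ht0
  set c : ℝ := t * τ / (2 * D) with hc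
  have hc0 : 0 < c := by positivity
  refine ⟨C / c + 4 / τ ^ 2, fun n hn => ?_⟩
  have hn' : (1 : ℝ) ≤ n := by exact_mod_cast hn
  have hn0 : (0 : ℝ) < n := by linarith
  set μ := Measure.pi fun _ : Fin n => F with hμ
  let G : Set (Fin n → ℝ≥0) := {v | (bidCount v t : ℝ) < τ / 2 * n}
  have hG : MeasurableSet G := measurableSet_lt
    ((measurable_from_top (f := fun k : ℕ => (k : ℝ))).comp (measurable_bidCount t))
    measurable_const
  have hGi : Integrable (G.indicator (1 : (Fin n → ℝ≥0) → ℝ)) μ :=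
    (integrable_const (1 : ℝ)).indicator hG
  have hpt : ∀ᵐ v ∂μ, (⨆ j, monopolisticAuction.discountRatio v j) ≤
      1 / c * discountMass v + G.indicator 1 v := by
    filter_upwards [ae_le_of_measure_Ioi_eq_zero F hD] with v hv
    by_cases hvG : v ∈ G
    · rw [Set.indicator_of_mem hvG, Pi.one_apply]
      have := discountMass_nonneg v
      have h1 := iSup_discountRatio_le_one v
      have h2 : 0 ≤ 1 / c * discountMass v := by positivity
      linarith
    · rw [Set.indicator_of_notMem hvG, add_zero]
      have hvG' : τ / 2 * n ≤ bidCount v t := not_lt.1 hvG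
      have hrev : (t : ℝ) * bidCount v t ≤ monopolyPrice v * bidCount v (monopolyPrice v) := by
        exact_mod_cast revenue_le_monopoly v t
      have hPD : (monopolyPrice v : ℝ) ≤ D := by
        exact_mod_cast monopolyPrice_le_of_forall_le hv
      have hcN : c ≤ bidCount v (monopolyPrice v) / n := by
        rw [hc, div_le_div_iff₀ (by positivity) hn0]
        have h1 : (t : ℝ) * (τ / 2 * n) ≤ t * bidCount v t := by gcongr
        have h2 : (monopolyPrice v : ℝ) * bidCount v (monopolyPrice v) ≤
            D * bidCount v (monopolyPrice v) := by gcongr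
        linarith
      have hs := iSup_discountRatio_nonneg v
      rw [one_div, le_inv_mul_iff₀ hc0, discountMass]
      gcongr
  have hle : ∫ v, (⨆ j, monopolisticAuction.discountRatio v j) ∂μ ≤
      1 / c * ∫ v, discountMass v ∂μ + μ.real G := by
    rw [← integral_indicator_one hG, ← integral_const_mul,
      ← integral_add ((integrable_discountMass F).const_mul _) hGi]
    exact integral_mono_ae (integrable_iSup_discountRatio F)
      (((integrable_discountMass F).const_mul _).add hGi) hpt
  have hsn : √(n : ℝ) ≤ n := by
    rw [Real.sqrt_le_left (by linarith)]
    nlinarith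
  have hs0 : 0 < √(n : ℝ) := Real.sqrt_pos.2 hn0
  calc ∫ v, (⨆ j, monopolisticAuction.discountRatio v j) ∂μ
      ≤ 1 / c * (C / √n) + 4 / τ ^ 2 / n := by
        refine hle.trans (add_le_add ?_ (prob_bidCount_lt_le F hn ht))
        exact mul_le_mul_of_nonneg_left (hmass F n hn) (by positivity)
    _ ≤ 1 / c * (C / √n) + 4 / τ ^ 2 / √n := by gcongr
    _ = _ := by field_simp

lemma maxDiscountRatio_isBigO (F : Measure ℝ≥0) [IsProbabilityMeasure F] {D : ℝ≥0}
    (hD : F (Set.Ioi D) = 0) :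
    (monopolisticAuction.maxDiscountRatio F) =O[atTop] (fun n : ℕ => 1 / √(n : ℝ)) := by
  obtain ⟨C, h⟩ := exists_integral_iSup_le F hD
  refine IsBigO.of_bound C (eventually_atTop.2 ⟨1, fun n hn => ?_⟩)
  have h0 : 0 ≤ monopolisticAuction.maxDiscountRatio F n :=
    integral_nonneg fun v => iSup_discountRatio_nonneg v
  rw [Real.norm_of_nonneg h0, Real.norm_of_nonneg (by positivity), mul_one_div]
  exact h n hn

end BoundedSupport

lemma tendsto_one_div_sqrt_atTop : Tendsto (fun n : ℕ => 1 / √(n : ℝ)) atTop (𝓝 0) := by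
  simp only [one_div]
  exact tendsto_inv_atTop_zero.comp (Real.tendsto_sqrt_atTop.comp tendsto_natCast_atTop_atTop)

theorem mainTheorem8 :
    monopolisticAuction.NearlyUIC ∧
    (∀ (F : Measure ℝ≥0) [IsProbabilityMeasure F], (∃ D : ℝ≥0, F (Set.Ioi D) = 0) →
      (∀ n : ℕ, Integrable
        (fun v : Fin n → ℝ≥0 => ⨆ j : Fin n, monopolisticAuction.discountRatio v j)
        (Measure.pi fun _ => F)) ∧
      Tendsto (monopolisticAuction.maxDiscountRatio F) atTop (𝓝 0) ∧
      (monopolisticAuction.maxDiscountRatio F) =O[atTop] (fun n : ℕ => 1 / √(n : ℝ))) ∧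
    (∀ (F : Measure ℝ≥0) [IsProbabilityMeasure F],
      (∀ (n : ℕ) (i : Fin n), Integrable
        (fun v : Fin n → ℝ≥0 => monopolisticAuction.discountRatio v i)
        (Measure.pi fun _ => F)) ∧
      Tendsto (monopolisticAuction.avgDiscountRatio F) atTop (𝓝 0) ∧
      (monopolisticAuction.avgDiscountRatio F) =O[atTop] (fun n : ℕ => 1 / √(n : ℝ))) := by
  refine ⟨⟨1 / 2, by norm_num, fun F _ => ⟨?_, ?_⟩⟩, fun F _ ⟨D, hD⟩ => ⟨?_, ?_, ?_⟩,
    fun F _ => ⟨?_, ?_, ?_⟩⟩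
  · exact (avgDiscountRatio_isBigO F).trans_tendsto tendsto_one_div_sqrt_atTop
  · simpa only [Real.sqrt_eq_rpow] using avgDiscountRatio_isBigO F
  · exact fun n => integrable_iSup_discountRatio F
  · exact (maxDiscountRatio_isBigO F hD).trans_tendsto tendsto_one_div_sqrt_atTop
  · exact maxDiscountRatio_isBigO F hD
  · exact fun n i => integrable_discountRatio F i
  · exact (avgDiscountRatio_isBigO F).trans_tendsto tendsto_one_div_sqrt_atTop
  · exact avgDiscountRatio_isBigO F
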